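/- Let $\mathbb{A}$ be the field of real algebraic numbers. A loop over a subring $R\subseteq\mathbb{A}$ in $d\ge 1$ variables $\vec x=(x_1,\dots,x_d)$ is a pair $(\varphi,\vec a)$, written "while $\varphi$ do $\vec x\leftarrow\vec a$", where $\varphi$ is a propositional formula over atoms $p\ge 0$, $p>0$ with $p\in R[\vec x]$, and $\vec a=(a_1,\dots,a_d)\in R[\vec x]^d$. It is *twn* if it is triangular (the transitive closure $\succ$ of $\{(x_i,x_j)\mid i\ne j,\ x_j \text{ occurs in } a_i\}$ is well founded) and weakly non-linear (for no $i$ does $x_i$ occur in a monomial of $a_i$ of degree $>1$). For an $\mathbb{A}$-algebra automorphism $\eta$ of $\mathbb{A}[\vec x]$ let $\deg(\eta)=\max_{1\le i\le d}\deg(\eta(x_i))$ and $$\mathit{Tr}_\eta(\varphi,\vec a)=\bigl(\eta^{-1}(\varphi),\ ((\eta^{-1}\circ\widetilde a\circ\eta)(x_1),\dots,(\eta^{-1}\circ\widetilde a\circ\eta)(x_d))\bigr),$$ where $\widetilde a$ is the endomorphism of $\mathbb{A}[\vec x]$ with $\widetilde a(x_i)=a_i$, and $\eta^{-1}(\varphi)$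 results from applying $\eta^{-1}$ to all polynomials in $\varphi$. The loop is *twn-transformable* if $\mathit{Tr}_\eta(\varphi,\vec a)$ is twn for some automorphism $\eta$ of $\mathbb{A}[\vec x]$. A *closed formula of $\mathrm{Th}_\exists(\mathbb{A})$* is a formula $\exists\vec y\in\mathbb{A}^k.\,\psi$ with $k\in\mathbb{N}$ and $\psi$ a propositional formula over atoms $p\ge 0$, $p>0$ with $p\in\mathbb{Q}[\vec y]$. As inputs and outputs of algorithms, real algebraic numbers are represented by an integer polynomial and an open interval with rational end points that contains exactly one root of it (the represented number); polynomials are represented as finite lists of monomials with coefficients, and formulas as words in prefix notation. **Theorem.** 1. There is an algorithm (a total computable function) that, given (a representation of) a loop $(\varphi,\vec a)$ over a subring $R\subseteq\mathbb{A}$ in $d\ge1$ variables and a number $\delta\in\mathbb{N}$, computes a closed formula $\chi$ of $\mathrm{Th}_\exists(\mathbb{A})$ such that $\chi$ is valid if and only if there is an automorphism $\eta$ of $\mathbb{A}[\vec x]$ with $\deg(\eta)\le\delta$ such that $\mathit{Tr}_\eta(\varphi,\vec a)$ is twn. In particular, for each $\delta\ge 0$, the question whether such an $\eta$ exists is reducible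 to validity in $\mathrm{Th}_\exists(\mathbb{A})$. 2. Twn-transformability is semi-decidable: there is a recursively enumerable set of representations which contains a given representation of a loop $(\varphi,\vec a)$ over a subring $R\subseteq\mathbb{A}$ in $d\ge1$ variables if and only if $(\varphi,\vec a)$ is twn-transformable. -/

import Mathlib

namespace TwnLoop

noncomputable section

/-- The field of real algebraic numbers (with the order inherited from `ℝ`). -/
abbrev RealAlg : Type := algebraicClosure ℚ ℝ

/-! ### Propositional formulas over polynomial inequations -/

/-- Propositional formulas over the atoms `p ≥ 0` and `p > 0` with `p` from `P`. -/
inductive PropFormula (P : Type) : Type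
  | ge (p : P) : PropFormula P
  | gt (p : P) : PropFormula P
  | neg (φ : PropFormula P) : PropFormula P
  | and (φ ψ : PropFormula P) : PropFormula P
  | or (φ ψ : PropFormula P) : PropFormula P

namespace PropFormula

/-- Apply a map to all polynomials that occur in a formula. -/
def map {P Q : Type} (f : P → Q) : PropFormula P → PropFormula Q
  | ge p => ge (f p)
  | gt p => gt (f p)
  | neg φ => neg (map f φ)
  | and φ ψ => and (map f φ) (map f ψ)
  | or φ ψ => or (map f φ) (map f ψ)

/-- Truth of a formula, where `val p` is the value of the polynomial `p`. -/
def Holds {P K : Type} [Zero K] [LE K] [LT K] (val : P → K) : PropFormula P → Prop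
  | ge p => 0 ≤ val p
  | gt p => 0 < val p
  | neg φ => ¬ Holds val φ
  | and φ ψ => Holds val φ ∧ Holds val ψ
  | or φ ψ => Holds val φ ∨ Holds val ψ

/-- Two formulas of the same shape whose corresponding atoms are related by `r`. -/
def Rel {P Q : Type} (r : P → Q → Prop) : PropFormula P → PropFormula Q → Prop
  | ge p, ge q => r p q
  | gt p, gt q => r p q
  | neg φ, neg φ' => Rel r φ φ'
  | and φ ψ, and φ' ψ' => Rel r φ φ' ∧ Rel r ψ ψ'
  | or φ ψ, or φ' ψ' => Rel r φ φ' ∧ Rel r ψ ψ'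
  | _, _ => False

/-- A formula over (codes of) polynomials, written down as a word in prefix (Polish) notation.
The letters are pairs of a tag (`0` for `≥`, `1` for `>`, `2` for `¬`, `3` for `∧`, `4` for `∨`)
and a polynomial code, which is the empty list if the tag is a connective. -/
def word {C : Type} : PropFormula (List C) → List (ℕ × List C)
  | ge p => [(0, p)]
  | gt p => [(1, p)]
  | neg φ => (2, []) :: word φ
  | and φ ψ => (3, []) :: (word φ ++ word ψ)
  | or φ ψ => (4, []) :: (word φ ++ word ψ)

end PropFormula

/-! ### Loops and their transformation by polynomial automorphisms -/

/-- A loop `while φ do x ← a` in `d` variables whose polynomials have coefficients in `K`. -/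
structure Loop (K : Type) [CommRing K] (d : ℕ) : Type where
  cond : PropFormula (MvPolynomial (Fin d) K)
  update : Fin d → MvPolynomial (Fin d) K

/-- `K`-automorphisms of the polynomial ring `K[x₁, …, x_d]`. -/
abbrev PolyAut (K : Type) [CommRing K] (d : ℕ) : Type :=
  MvPolynomial (Fin d) K ≃ₐ[K] MvPolynomial (Fin d) K

/-- `deg η = max_i deg (η x_i)`. -/
def PolyAut.deg {K : Type} [CommRing K] {d : ℕ} (η : PolyAut K d) : ℕ :=
  Finset.univ.sup fun i : Fin d => (η (MvPolynomial.X i)).totalDegree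

namespace Loop

variable {K : Type} [CommRing K] {d : ℕ}

/-- A loop over a subring, regarded as a loop over the whole ring. -/
def baseChange {R : Subring K} (L : Loop R d) : Loop K d where
  cond := L.cond.map (MvPolynomial.map R.subtype)
  update i := MvPolynomial.map R.subtype (L.update i)

/-- The endomorphism `ã` with `ã (x_i) = a_i` that is induced by the update `a`. -/
def updateEnd (L : Loop K d) : MvPolynomial (Fin d) K →ₐ[K] MvPolynomial (Fin d) K :=
  MvPolynomial.aeval L.update

/-- `Tr_η (φ, a) = (η⁻¹ (φ), (η⁻¹ ∘ ã ∘ η) (x))`. -/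
def Tr (η : PolyAut K d) (L : Loop K d) : Loop K d where
  cond := L.cond.map η.symm
  update i := η.symm (L.updateEnd (η (MvPolynomial.X i)))

/-- `x_i ≻ x_j`: the transitive closure of "`i ≠ j` and `x_j` occurs in `a_i`". -/
def Succ (L : Loop K d) : Fin d → Fin d → Prop :=
  Relation.TransGen fun i j => i ≠ j ∧ j ∈ (L.update i).vars

/-- The relation `≻` is well founded, i.e., there is no infinite chain `x_i ≻ x_j ≻ ⋯`. -/
def Triangular (L : Loop K d) : Prop :=
  WellFounded fun j i => L.Succ i j

/-- For no `i`, the variable `x_i` occurs in a non-linear monomial of `a_i`. -/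
def WeaklyNonlinear (L : Loop K d) : Prop :=
  ∀ i, ∀ m ∈ (L.update i).support, m i ≠ 0 → m.degree ≤ 1

/-- Triangular weakly non-linear loops. -/
def IsTwn (L : Loop K d) : Prop :=
  L.Triangular ∧ L.WeaklyNonlinear

end Loop

/-- A loop over a subring of the real algebraic numbers is twn-transformable if it can be
transformed into a twn-loop by an automorphism over the real algebraic numbers. -/
def TwnTransformable {R : Subring RealAlg} {d : ℕ} (L : Loop R d) : Prop :=
  ∃ η : PolyAut RealAlg d, (L.baseChange.Tr η).IsTwn

/-! ### The existential theory of the real algebraic numbers -/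

/-- A closed formula `∃ y ∈ 𝔸^k. ψ`, where `ψ` is a propositional formula over the atoms
`p ≥ 0` and `p > 0` with `p ∈ ℚ[y]`. -/
structure ExSentence : Type where
  k : ℕ
  matrix : PropFormula (MvPolynomial (Fin k) ℚ)

/-- Validity over the real algebraic numbers. -/
def ExSentence.Valid (χ : ExSentence) : Prop :=
  ∃ y : Fin χ.k → RealAlg, χ.matrix.Holds fun p => MvPolynomial.aeval y p

/-! ### Finite representations as inputs and outputs of algorithms -/

/-- Rational numbers: `(n, m)` stands for `n / (m + 1)`. -/
abbrev RatCode : Type := ℤ × ℕ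

/-- The rational number with the given code. -/
def RatCode.val (q : RatCode) : ℚ := (q.1 : ℚ) / ((q.2 : ℚ) + 1)

/-- Real algebraic numbers in isolating interval representation: the coefficients
`c₀, c₁, …` of an integer polynomial `c₀ + c₁ t + ⋯`, and the end points of an open interval. -/
abbrev AlgCode : Type := List ℤ × RatCode × RatCode

/-- `t` is a root in the given interval of the given polynomial. -/
def AlgCode.IsRoot (c : AlgCode) (t : RealAlg) : Prop :=
  (c.2.1.val : RealAlg) < t ∧ t < (c.2.2.val : RealAlg) ∧
    ∑ j : Fin c.1.length, (c.1.get j : RealAlg) * t ^ (j : ℕ) = 0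

/-- `α` is the only root in the given interval of the given polynomial. -/
def AlgCode.Denotes (c : AlgCode) (α : RealAlg) : Prop :=
  c.IsRoot α ∧ ∀ β : RealAlg, c.IsRoot β → β = α

/-- Polynomials are written as lists of pairs of (the code of) a coefficient and a list of
exponents, one such pair for each addend. -/
abbrev PolyCode (C : Type) : Type := List (C × List ℕ)

/-- The exponent vector that is written as the list `l`. -/
def exponents (d : ℕ) (l : List ℕ) : Fin d →₀ ℕ :=
  Finsupp.equivFunOnFinite.symm fun i => l.getD i 0

/-- The polynomial `p` is the sum of the listed addends; `r` says which coefficient is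
represented by which code. -/
def PolyCode.Denotes {C K : Type} [CommSemiring K] (r : C → K → Prop) {d : ℕ}
    (c : PolyCode C) (p : MvPolynomial (Fin d) K) : Prop :=
  ∃ α : Fin c.length → K, (∀ j, r (c.get j).1 (α j)) ∧
    p = ∑ j, MvPolynomial.monomial (exponents d (c.get j).2) (α j)

/-- Codes of formulas: words over tags and codes of polynomials. -/
abbrev FormulaCode (C : Type) : Type := List (ℕ × PolyCode C)

/-- The word `w` is the prefix notation of the formula `φ`. -/
def FormulaCode.Denotes {C K : Type} [CommSemiring K] (r : C → K → Prop) {d : ℕ}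
    (w : FormulaCode C) (φ : PropFormula (MvPolynomial (Fin d) K)) : Prop :=
  ∃ ψ : PropFormula (PolyCode C), ψ.word = w ∧ PropFormula.Rel (PolyCode.Denotes r) ψ φ

/-- Codes of loops: the number of variables, the update, and the condition. -/
abbrev LoopCode : Type := ℕ × List (PolyCode AlgCode) × FormulaCode AlgCode

/-- `c` is a code of the loop `L` whose coefficients are real algebraic numbers. -/
def LoopCode.Denotes {d : ℕ} (c : LoopCode) (L : Loop RealAlg d) : Prop :=
  c.1 = d ∧
  (∃ h : c.2.1.length = d, ∀ i : Fin d,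
    PolyCode.Denotes AlgCode.Denotes (c.2.1.get (i.cast h.symm)) (L.update i)) ∧
  FormulaCode.Denotes AlgCode.Denotes c.2.2 L.cond

/-- Codes of closed existential formulas: the number of variables, and the quantifier-free part. -/
abbrev ExCode : Type := ℕ × FormulaCode RatCode

/-- `c` is a code of the closed existential formula `χ`. -/
def ExCode.Denotes (c : ExCode) (χ : ExSentence) : Prop :=
  c.1 = χ.k ∧ FormulaCode.Denotes (fun (q : RatCode) (x : ℚ) => q.val = x) c.2 χ.matrix

end

end TwnLoop

/-!
Whether some automorphism `η` of degree at most `δ` transforms a loop into a twn-loop is expressed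
by a finite system of constraints `p = 0 ∨ q > 0` over the rationals. Its unknowns are the
coefficients of `f_i = η (x_i)`, of `g_i = η⁻¹ (x_i)` and of the transformed update `b_i`, together
with the coefficients of the loop (pinned down by their isolating intervals) and with a number `r_i`
for each variable. The system says that the substitutions by `f` and `g` are inverse to each other,
that `b_i = f_i (a (g))`, that every non-linear monomial with `x_i` is missing in `b_i`, and that
`r_j < r_i` whenever some other `x_j` occurs in `b_i`; on finitely many variables such numbers exist
iff `≻` is well founded.

* The system is finite because the degree of `η⁻¹` is bounded in terms of `d` and `δ`
  (`totalDegree_symm_le`). A dimension count gives a polynomial relation of bounded degree between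
  `x_i` and `f_1, …, f_d`. Applying `η⁻¹` turns it into a relation between `g_i` and the variables,
  so `g_i` is a root of a nonzero univariate polynomial over `𝔸[x]` with coefficients of bounded
  degree, and it has to divide one of the nonzero coefficients.
* Polynomial identities of bounded degree are expressed by evaluation on a grid of integer points
  (`eq_of_eval_eq_on_grid`), where the intermediate values are additional unknowns. In this way the
  system is written down without any symbolic computation with polynomials, and it is a primitive
  recursive function of the code of the loop (`primrec_system`). Its correctness is
  `exists_sat_system_iff`.
* Twn-transformability is the satisfiability of one of these systems for `δ = 0, 1, 2, …`, and
  satisfiability over `𝔸` has certificates that can be checked by rational arithmetic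
  (`exists_sat_of_certifies`, `exists_certifies_of_sat`). Indeed `q > 0` holds iff `q * s ^ 2 = 1`
  for some `s`, and by the primitive element theorem all finitely many numbers in question are
  rational polynomials in a single `θ`. A polynomial `f` that changes its sign between two rational
  points has a root in `𝔸`, the minimal polynomial of `θ` is of this kind up to its sign, and an
  equation between polynomials in `θ` is certified by a multiple of `f`.
-/

namespace TwnLoop

/-! ### Primitive recursion on integers, fractions and polynomials -/

open Primrec

section Basics

variable {α β σ : Type*} [Primcodable α] [Primcodable β] [Primcodable σ]

theorem primrec_list_sum_nat : Primrec (List.sum : List ℕ → ℕ) :=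
  (list_foldr Primrec.id (const 0) (nat_add.comp (fst.comp snd) (snd.comp snd)).to₂).of_eq
    fun _ => rfl

theorem primrec_list_replicate : Primrec₂ (List.replicate : ℕ → α → List α) :=
  (list_map (list_range.comp fst) (snd.comp fst).to₂).of_eq fun x => by
    simp [List.map_const']

theorem primrec_list_count_encode :
    Primrec₂ fun (l : List α) (i : ℕ) => (l.map Encodable.encode).count i := by
  have h : PrimrecRel fun (j i : ℕ) => j = i := Primrec.eq
  exact (list_length.comp
    (h.listFilter.comp (list_map fst (Primrec.encode.comp snd).to₂) snd)).of_eq fun x => by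
      simp only [List.count, List.countP_eq_length_filter]; rfl

theorem primrec_nat_pow : Primrec₂ ((· ^ ·) : ℕ → ℕ → ℕ) :=
  Primrec₂.unpaired'.1 Nat.Primrec.pow

end Basics

section Int

theorem encode_int (z : ℤ) :
    Encodable.encode z = if 0 ≤ z then 2 * z.toNat else 2 * ((-z).toNat - 1) + 1 := by
  cases z with
  | ofNat n => rfl
  | negSucc n =>
    rw [if_neg (by simp)]
    simp only [Int.neg_negSucc]
    rfl

theorem primrec_int_toNat : Primrec Int.toNat := by
  have h : Primrec fun z : ℤ => cond (Encodable.encode z).bodd 0 (Encodable.encode z).div2 :=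
    Primrec.cond (nat_bodd.comp Primrec.encode) (const 0) (nat_div2.comp Primrec.encode)
  refine h.of_eq fun z => ?_
  rw [encode_int]
  split_ifs with hz
  · simp [Nat.bodd_mul, Nat.div2_val]
  · simp [Nat.bodd_mul]; omega

theorem primrec_int_toNat_neg : Primrec fun z : ℤ => (-z).toNat := by
  have h : Primrec fun z : ℤ =>
      cond (Encodable.encode z).bodd ((Encodable.encode z).div2 + 1) 0 :=
    Primrec.cond (nat_bodd.comp Primrec.encode)
      (Primrec.succ.comp (nat_div2.comp Primrec.encode)) (const 0)
  refine h.of_eq fun z => ?_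
  rw [encode_int]
  split_ifs with hz
  · simp [Nat.bodd_mul]; omega
  · simp [Nat.bodd_mul, Nat.div2_val]; omega

theorem primrec_int_natSub : Primrec₂ fun m n : ℕ => (m : ℤ) - n := by
  have h : Primrec₂ fun m n : ℕ => if n ≤ m then 2 * (m - n) else 2 * (n - m - 1) + 1 :=
    Primrec.ite (nat_le.comp snd fst) (nat_double.comp (nat_sub.comp fst snd))
      (nat_double_succ.comp (nat_sub.comp (nat_sub.comp snd fst) (const 1)))
  refine Primrec₂.encode_iff.1 (h.of_eq fun m n => ?_)
  rw [encode_int]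
  split_ifs <;> omega

theorem primrec_int_ofNat : Primrec fun n : ℕ => (n : ℤ) :=
  (primrec_int_natSub.comp Primrec.id (const 0)).of_eq fun n => by simp

theorem primrec_int_add : Primrec₂ ((· + ·) : ℤ → ℤ → ℤ) :=
  (primrec_int_natSub.comp
    (nat_add.comp (primrec_int_toNat.comp fst) (primrec_int_toNat.comp snd))
    (nat_add.comp (primrec_int_toNat_neg.comp fst) (primrec_int_toNat_neg.comp snd))).of_eq
    fun x => by change _ = x.1 + x.2; omega

theorem primrec_int_neg : Primrec fun z : ℤ => -z :=
  (primrec_int_natSub.comp primrec_int_toNat_neg primrec_int_toNat).of_eq fun x => by omega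

theorem primrec_int_mul : Primrec₂ ((· * ·) : ℤ → ℤ → ℤ) := by
  have h₁ := primrec_int_toNat.comp (fst (α := ℤ) (β := ℤ))
  have h₂ := primrec_int_toNat.comp (snd (α := ℤ) (β := ℤ))
  have h₃ := primrec_int_toNat_neg.comp (fst (α := ℤ) (β := ℤ))
  have h₄ := primrec_int_toNat_neg.comp (snd (α := ℤ) (β := ℤ))
  refine (primrec_int_natSub.comp (nat_add.comp (nat_mul.comp h₁ h₂) (nat_mul.comp h₃ h₄))
    (nat_add.comp (nat_mul.comp h₁ h₄) (nat_mul.comp h₃ h₂))).of_eq fun x => ?_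
  obtain ⟨a, b⟩ := x
  have ha : a = a.toNat - (-a).toNat := by omega
  have hb : b = b.toNat - (-b).toNat := by omega
  conv_rhs => rw [ha, hb]
  push_cast
  ring

end Int

/-! ### Arithmetic on codes of rational numbers -/

namespace RatCode

/-- Addition of fractions, without cancelling. -/
def add (p q : RatCode) : RatCode :=
  (p.1 * ((q.2 + 1 : ℕ) : ℤ) + q.1 * ((p.2 + 1 : ℕ) : ℤ), (p.2 + 1) * (q.2 + 1) - 1)

/-- Multiplication of fractions, without cancelling. -/
def mul (p q : RatCode) : RatCode := (p.1 * q.1, (p.2 + 1) * (q.2 + 1) - 1)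

theorem den_cast (m n : ℕ) :
    (((m + 1) * (n + 1) - 1 : ℕ) : ℚ) + 1 = ((m : ℚ) + 1) * ((n : ℚ) + 1) := by
  rw [Nat.cast_sub (Nat.mul_pos m.succ_pos n.succ_pos)]
  push_cast
  ring

@[simp] theorem val_add (p q : RatCode) : (add p q).val = p.val + q.val := by
  have hp : (p.2 : ℚ) + 1 ≠ 0 := by positivity
  have hq : (q.2 : ℚ) + 1 ≠ 0 := by positivity
  simp only [val, add, den_cast]
  push_cast
  field_simp

@[simp] theorem val_mul (p q : RatCode) : (mul p q).val = p.val * q.val := by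
  have hp : (p.2 : ℚ) + 1 ≠ 0 := by positivity
  have hq : (q.2 : ℚ) + 1 ≠ 0 := by positivity
  simp only [val, mul, den_cast]
  push_cast
  field_simp

@[simp] theorem val_int (z : ℤ) : val (z, 0) = z := by simp [val]

theorem val_eq_zero {q : RatCode} : q.val = 0 ↔ q.1 = 0 := by
  have hq : (q.2 : ℚ) + 1 ≠ 0 := by positivity
  simp [val, hq]

theorem val_pos {q : RatCode} : 0 < q.val ↔ 0 < q.1 := by
  have hq : (0 : ℚ) < (q.2 : ℚ) + 1 := by positivity
  simp [val, div_pos_iff_of_pos_right hq]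

theorem exists_val_eq (x : ℚ) : ∃ q : RatCode, q.val = x := by
  refine ⟨(x.num, x.den - 1), ?_⟩
  rw [val, Nat.cast_sub x.pos]
  simp [Rat.num_div_den]

theorem primrec_add : Primrec₂ add := by
  have hs : Primrec fun q : RatCode => ((q.2 + 1 : ℕ) : ℤ) :=
    primrec_int_ofNat.comp (Primrec.succ.comp snd)
  refine Primrec.pair (primrec_int_add.comp
    (primrec_int_mul.comp (fst.comp fst) (hs.comp snd))
    (primrec_int_mul.comp (fst.comp snd) (hs.comp fst))) ?_
  exact nat_sub.comp (nat_mul.comp (Primrec.succ.comp (snd.comp fst))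
    (Primrec.succ.comp (snd.comp snd))) (const 1)

theorem primrec_mul : Primrec₂ mul :=
  Primrec.pair (primrec_int_mul.comp (fst.comp fst) (fst.comp snd))
    (nat_sub.comp (nat_mul.comp (Primrec.succ.comp (snd.comp fst))
      (Primrec.succ.comp (snd.comp snd))) (const 1))

end RatCode

/-! ### Arithmetic on univariate polynomials given by coefficient lists -/

/-- Univariate rational polynomials, given by the list of their coefficients
(constant coefficient first). -/
abbrev UPoly : Type := List RatCode

namespace UPoly

open Polynomial

/-- The polynomial with the given list of coefficients. -/
noncomputable def toPoly : UPoly → ℚ[X]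
  | [] => 0
  | c :: l => C c.val + X * toPoly l

/-- Coefficientwise addition. The length of the result is an upper bound for both lengths; the
excess coefficients vanish. -/
def add (p q : UPoly) : UPoly :=
  (List.range (p.length + q.length)).map fun i =>
    RatCode.add (p.getD i (0, 0)) (q.getD i (0, 0))

/-- Multiplication by the schoolbook method. -/
def mul (p q : UPoly) : UPoly :=
  p.foldr (fun c r => add (q.map (RatCode.mul c)) ((0, 0) :: r)) []

theorem coeff_toPoly (p : UPoly) (i : ℕ) : (toPoly p).coeff i = (p.getD i (0, 0)).val := by
  induction p generalizing i with
  | nil => simp [toPoly]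
  | cons c l ih => cases i with
    | zero => simp [toPoly]
    | succ i => simp [toPoly, ih]

@[simp] theorem toPoly_add (p q : UPoly) : toPoly (add p q) = toPoly p + toPoly q := by
  ext i
  rw [coeff_add, coeff_toPoly, coeff_toPoly, coeff_toPoly, add]
  by_cases hi : i < p.length + q.length
  · simp [List.getD_eq_getElem?_getD, hi]
  · rw [List.getD_eq_default _ _ (by simp; omega), List.getD_eq_default _ _ (by omega),
      List.getD_eq_default _ _ (by omega)]
    simp

theorem toPoly_map_mul (c : RatCode) (q : UPoly) :
    toPoly (q.map (RatCode.mul c)) = C c.val * toPoly q := by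
  induction q with
  | nil => simp [toPoly]
  | cons a l ih => simp [toPoly, ih]; ring

@[simp] theorem toPoly_mul (p q : UPoly) : toPoly (mul p q) = toPoly p * toPoly q := by
  induction p with
  | nil => simp [toPoly, mul]
  | cons c l ih =>
    have : mul (c :: l) q = add (q.map (RatCode.mul c)) ((0, 0) :: mul l q) := rfl
    rw [this, toPoly_add, toPoly_map_mul]
    simp only [toPoly, ih]
    simp
    ring

theorem exists_toPoly_eq (p : ℚ[X]) : ∃ l : UPoly, toPoly l = p := by
  choose r hr using RatCode.exists_val_eq
  refine ⟨(List.range (p.natDegree + 1)).map fun i => r (p.coeff i), ?_⟩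
  ext i
  rw [coeff_toPoly]
  by_cases hi : i < p.natDegree + 1
  · simp [List.getD_eq_getElem?_getD, hi, hr]
  · rw [List.getD_eq_default _ _ (by simp; omega),
      coeff_eq_zero_of_natDegree_lt (by omega)]
    simp

/-- All listed coefficients vanish. -/
def IsZero (p : UPoly) : Prop := ∀ c ∈ p, c.1 = 0

theorem isZero_iff (p : UPoly) : IsZero p ↔ toPoly p = 0 := by
  induction p with
  | nil => simp [IsZero, toPoly]
  | cons c l ih =>
    rw [IsZero, List.forall_mem_cons, ← IsZero, ih, ← RatCode.val_eq_zero, toPoly]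
    constructor
    · rintro ⟨h₁, h₂⟩
      simp [h₁, h₂]
    · intro h
      have h₀ : c.val = 0 := by simpa using congrArg (coeff · 0) h
      refine ⟨h₀, ?_⟩
      simpa [h₀] using h

theorem primrec_add : Primrec₂ add := by
  refine list_map (list_range.comp (nat_add.comp (list_length.comp fst) (list_length.comp snd))) ?_
  exact RatCode.primrec_add.comp ((list_getD _).comp (fst.comp fst) snd)
    ((list_getD _).comp (snd.comp fst) snd)

theorem primrec_mul : Primrec₂ mul := by
  have h : Primrec₂ fun (x : UPoly × UPoly) (y : RatCode × UPoly) =>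
      add (x.2.map (RatCode.mul y.1)) ((0, 0) :: y.2) :=
    primrec_add.comp (list_map (snd.comp fst)
      (RatCode.primrec_mul.comp (fst.comp (snd.comp fst)) snd).to₂)
      (list_cons.comp (const (0, 0)) (snd.comp snd))
  exact list_foldr fst (const []) h

theorem primrecPred_isZero : PrimrecPred IsZero :=
  PrimrecPred.forall_mem_list (Primrec.eq.comp fst (const 0))

/-- The value at a rational point. -/
def eval (x : RatCode) (p : UPoly) : RatCode :=
  p.foldr (fun c r => RatCode.add c (RatCode.mul x r)) (0, 0)

@[simp] theorem val_eval (x : RatCode) (p : UPoly) :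
    (eval x p).val = (toPoly p).eval x.val := by
  induction p with
  | nil => simp [eval, toPoly]
  | cons c l ih =>
    have : eval x (c :: l) = RatCode.add c (RatCode.mul x (eval x l)) := rfl
    rw [this, RatCode.val_add, RatCode.val_mul, ih, toPoly]
    simp

theorem primrec_eval : Primrec₂ eval := by
  have h : Primrec₂ fun (x : RatCode × UPoly) (y : RatCode × RatCode) =>
      RatCode.add y.1 (RatCode.mul x.1 y.2) :=
    RatCode.primrec_add.comp (fst.comp snd)
      (RatCode.primrec_mul.comp (fst.comp fst) (snd.comp snd))
  exact list_foldr snd (const (0, 0)) h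

end UPoly

/-! ### Systems of polynomial constraints in named variables -/

/-- Names of real unknowns: a tag for the kind of the unknown, an index, and a list of numbers. -/
abbrev Name : Type := ℕ × ℕ × List ℕ

/-- Integer polynomials in named variables: lists of addends, each consisting of a coefficient and
the list of the variables that are multiplied (with repetitions). -/
abbrev NPoly : Type := List (ℤ × List Name)

/-- The pair `(p, q)` stands for the constraint `p = 0 ∨ q > 0`. -/
abbrev Constraint : Type := NPoly × NPoly

namespace NPoly

/-- The value of a polynomial under an assignment of values to the names. -/
def eval {K : Type*} [CommRing K] (y : Name → K) (p : NPoly) : K :=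
  (p.map fun m => (m.1 : K) * (m.2.map y).prod).sum

theorem map_eval {K K' : Type*} [CommRing K] [CommRing K'] (f : K →+* K') (y : Name → K)
    (p : NPoly) : f (eval y p) = eval (fun v => f (y v)) p := by
  simp [eval, map_list_sum, map_list_prod, Function.comp_def]

@[simp] theorem eval_nil {K : Type*} [CommRing K] (y : Name → K) : eval y [] = 0 := rfl

@[simp] theorem eval_cons {K : Type*} [CommRing K] (y : Name → K) (m : ℤ × List Name)
    (p : NPoly) : eval y (m :: p) = (m.1 : K) * (m.2.map y).prod + eval y p := by
  simp [eval]

@[simp] theorem eval_append {K : Type*} [CommRing K] (y : Name → K) (p q : NPoly) :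
    eval y (p ++ q) = eval y p + eval y q := by
  simp [eval]

end NPoly

/-- The assignment `y` satisfies the constraint. -/
def Constraint.Sat {K : Type*} [CommRing K] [LT K] (y : Name → K) (C : Constraint) : Prop :=
  C.1.eval y = 0 ∨ 0 < C.2.eval y

/-! ### The constraint system of a loop -/

/-- All words of length at most `n` over the letters `0, …, k - 1`. They serve as notations for
monomials of degree at most `n` (several words may denote the same monomial), and as grid points. -/
def words (k : ℕ) : ℕ → List (List ℕ)
  | 0 => [[]]
  | n + 1 => [] :: (List.range k).flatMap fun i => (words k n).map fun u => i :: u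

/-- Coefficients of the polynomials `η (x_i)`. -/
abbrev tagAut : ℕ := 0
/-- Coefficients of the polynomials `η⁻¹ (x_i)`. -/
abbrev tagInv : ℕ := 1
/-- Coefficients of the transformed update. -/
abbrev tagUpd : ℕ := 2
/-- Coordinates of the grid points. -/
abbrev tagPt : ℕ := 3
/-- Values of `η⁻¹ (x_i)` at the grid points. -/
abbrev tagPtInv : ℕ := 4
/-- Values of `η (x_i)` at the grid points. -/
abbrev tagPtAut : ℕ := 5
/-- Values of the update of the loop at the images of the grid points under `η⁻¹ (x)`. -/
abbrev tagPtLoop : ℕ := 6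
/-- Values of the transformed update at the grid points. -/
abbrev tagPtUpd : ℕ := 7
/-- Numbers that decrease along `≻`. -/
abbrev tagRank : ℕ := 8
/-- Coefficients of the given loop. -/
abbrev tagAlg : ℕ := 9

/-- The name of the real algebraic number with the given code. -/
def algName (c : AlgCode) : Name := (tagAlg, Encodable.encode c, [])

/-- The constraints that force the unknown `algName c` to be the number that is denoted by `c`. -/
def algConstraints (c : AlgCode) : List Constraint :=
  [((List.range c.1.length).map fun j => (c.1.getD j 0, List.replicate j (algName c)), []),
   ([(1, [])], [(((c.2.1.2 + 1 : ℕ) : ℤ), [algName c]), (-c.2.1.1, [])]),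
   ([(1, [])], [(c.2.2.1, []), (-((c.2.2.2 + 1 : ℕ) : ℤ), [algName c])])]

/-- The constraint "the polynomial `∑ u, y_(t, i, u) * x_u`, where `u` ranges over the words of
length at most `D`, maps the point with the coordinates `y_(s, l, n)` to `y_(s', i, n)`". -/
def mapConstraint (d D t s s' i : ℕ) (n : List ℕ) : Constraint :=
  ((words d D).map (fun u => ((1 : ℤ), (t, i, u) :: u.map fun l => (s, l, n))) ++
    [(-1, [(s', i, n)])], [])

/-- The constraint "the listed polynomial maps the point with the coordinates `y_(s, l, n)` to
`y_(s', i, n)`". -/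
def loopConstraint (d s s' : ℕ) (p : PolyCode AlgCode) (i : ℕ) (n : List ℕ) : Constraint :=
  (p.map (fun m => ((1 : ℤ), algName m.1 ::
      (List.range d).flatMap fun l => List.replicate (m.2.getD l 0) (s, l, n))) ++
    [(-1, [(s', i, n)])], [])

/-- The constraint "the `i`-th coordinate of the grid point `n` is `n_i`". -/
def pointConstraint (i : ℕ) (n : List ℕ) : Constraint :=
  ([(1, [(tagPt, i, n)]), (-(n.getD i 0 : ℤ), [])], [])

/-- The constraint for a letter `j` of the word `u` which says that the transformed update may
contain the monomial `x_u` in its `i`-th component only if this is compatible with being twn. -/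
def twnConstraint (i : ℕ) (u : List ℕ) (j : ℕ) : Constraint :=
  ([(1, [(tagUpd, i, u)])],
    if j = i ∧ u.length ≤ 1 then [(1, [])] else [(1, [(tagRank, i, [])]), (-1, [(tagRank, j, [])])])

/-- An upper bound on the degree of the update. -/
def loopDeg (c : LoopCode) : ℕ := (c.2.1.flatten.map fun m => m.2.sum).sum

/-- An upper bound on the degree of the inverse of an automorphism of degree at most `δ` of the
polynomial ring in `d` variables. Using `δ + 1` instead of `δ` spares a case distinction for
`δ = 0`. -/
def invDeg (d δ : ℕ) : ℕ := d * ((d + 1) * (δ + 1)) ^ d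

/-- An upper bound on the degree of the transformed update. -/
def updDeg (x : LoopCode × ℕ) : ℕ := x.2 * (loopDeg x.1 * invDeg x.1.1 x.2)

/-- An upper bound on the degrees of all polynomials that have to be compared on the grid; the last
summand is for the degree of the variables. -/
def gridSize (x : LoopCode × ℕ) : ℕ := x.2 * invDeg x.1.1 x.2 + updDeg x + 1

/-- The constraints for the component `i` and the grid point `n`. -/
def gridConstraints (x : LoopCode × ℕ) (i : ℕ) (n : List ℕ) : List Constraint :=
  [pointConstraint i n,
   mapConstraint x.1.1 (invDeg x.1.1 x.2) tagInv tagPt tagPtInv i n,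
   mapConstraint x.1.1 x.2 tagAut tagPtInv tagPt i n,
   mapConstraint x.1.1 x.2 tagAut tagPt tagPtAut i n,
   mapConstraint x.1.1 (invDeg x.1.1 x.2) tagInv tagPtAut tagPt i n,
   loopConstraint x.1.1 tagPtInv tagPtLoop (x.1.2.1.getD i []) i n,
   mapConstraint x.1.1 x.2 tagAut tagPtLoop tagPtUpd i n,
   mapConstraint x.1.1 (updDeg x) tagUpd tagPt tagPtUpd i n]

/-- The grid points: lists of length at most `d` (to be continued by `0`). -/
def gridPoints (x : LoopCode × ℕ) : List (List ℕ) := words (gridSize x + 1) x.1.1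

/-- The system of constraints that is satisfiable iff the given loop can be transformed into a
twn-loop by an automorphism whose degree is at most the given number. -/
def system (x : LoopCode × ℕ) : List Constraint :=
  (List.range x.1.1).flatMap (fun i => (gridPoints x).flatMap (gridConstraints x i)) ++
  ((List.range x.1.1).flatMap (fun i => (words x.1.1 (updDeg x)).flatMap fun u =>
      u.map (twnConstraint i u)) ++
    x.1.2.1.flatten.flatMap fun m => algConstraints m.1)

/-! ### From constraint systems to existential formulas -/

/-- A number that exceeds the codes of all names in the system. -/
def numVars (S : List Constraint) : ℕ :=
  ((S.flatMap fun C => (C.1 ++ C.2).flatMap Prod.snd).map Encodable.encode).sum + 1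

/-- The polynomial in the variables `y₀, …, y_(k-1)` that arises by numbering the names. -/
def NPoly.toPolyCode (k : ℕ) (p : NPoly) : PolyCode RatCode :=
  p.map fun m => ((m.1, 0), (List.range k).map fun i => (m.2.map Encodable.encode).count i)

/-- The formula `p = 0 ∨ q > 0`, where `p = 0` is expressed by `p ≥ 0 ∧ ¬ p > 0`. -/
def Constraint.toFormula (k : ℕ) (C : Constraint) : PropFormula (PolyCode RatCode) :=
  .or (.and (.ge (C.1.toPolyCode k)) (.neg (.gt (C.1.toPolyCode k)))) (.gt (C.2.toPolyCode k))

/-- The conjunction of all constraints. -/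
def systemFormula (k : ℕ) (S : List Constraint) : PropFormula (PolyCode RatCode) :=
  S.foldr (fun C φ => .and (C.toFormula k) φ) (.ge [])

/-- The prefix notation of a constraint. -/
def Constraint.toWord (k : ℕ) (C : Constraint) : FormulaCode RatCode :=
  [(4, []), (3, []), (0, C.1.toPolyCode k), (2, []), (1, C.1.toPolyCode k),
    (1, C.2.toPolyCode k)]

/-- The prefix notation of the conjunction of all constraints. -/
def systemWord (k : ℕ) (S : List Constraint) : FormulaCode RatCode :=
  S.foldr (fun C w => (3, []) :: (C.toWord k ++ w)) [(0, [])]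

theorem word_systemFormula (k : ℕ) (S : List Constraint) :
    (systemFormula k S).word = systemWord k S := by
  induction S with
  | nil => rfl
  | cons C S ih =>
    simp only [systemFormula, systemWord, List.foldr_cons, PropFormula.word] at ih ⊢
    rw [ih]
    rfl

/-- The reduction to the existential theory of the real algebraic numbers. -/
def reduction (x : LoopCode × ℕ) : ExCode :=
  (numVars (system x), systemWord (numVars (system x)) (system x))

/-! ### The reduction is primitive recursive -/

section Primrec

open Primrec

variable {α : Type*} [Primcodable α]

theorem primrec_words : Primrec₂ words := by
  have h : Primrec₂ fun (k : ℕ) (x : ℕ × List (List ℕ)) =>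
      [] :: (List.range k).flatMap fun i => x.2.map fun u => i :: u := by
    refine list_cons.comp (const []) (list_flatMap (list_range.comp fst) ?_)
    exact list_map (snd.comp (snd.comp fst)) (list_cons.comp (snd.comp fst) snd).to₂
  refine (nat_rec (f := fun _ : ℕ => [([] : List ℕ)]) (const _) h).of_eq fun k n => ?_
  induction n with
  | zero => rfl
  | succ n ih => simp only [words, ← ih]

theorem primrec_name {f g : α → ℕ} {h : α → List ℕ} (hf : Primrec f) (hg : Primrec g)
    (hh : Primrec h) : Primrec fun a => ((f a, g a, h a) : Name) :=
  hf.pair (hg.pair hh)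

theorem primrec_algName : Primrec algName :=
  primrec_name (const _) Primrec.encode (const _)

theorem primrec_singleton : Primrec fun a : α => [a] :=
  list_cons.comp Primrec.id (const [])

theorem primrec_algConstraints : Primrec algConstraints := by
  have hn : Primrec fun c : AlgCode => [algName c] := primrec_singleton.comp primrec_algName
  have hs : Primrec fun q : RatCode => ((q.2 + 1 : ℕ) : ℤ) :=
    primrec_int_ofNat.comp (Primrec.succ.comp snd)
  have h₁ : Primrec fun c : AlgCode =>
      (List.range c.1.length).map fun j => (c.1.getD j 0, List.replicate j (algName c)) := by
    refine list_map (list_range.comp (list_length.comp fst)) ?_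
    exact ((list_getD 0).comp (fst.comp fst) snd).pair
      (primrec_list_replicate.comp snd (primrec_algName.comp fst))
  have h₂ : Primrec fun c : AlgCode =>
      ([(((c.2.1.2 + 1 : ℕ) : ℤ), [algName c]), (-c.2.1.1, [])] : NPoly) :=
    list_cons.comp ((hs.comp (fst.comp snd)).pair hn) (primrec_singleton.comp
      ((primrec_int_neg.comp (fst.comp (fst.comp snd))).pair (const [])))
  have h₃ : Primrec fun c : AlgCode =>
      ([(c.2.2.1, []), (-((c.2.2.2 + 1 : ℕ) : ℤ), [algName c])] : NPoly) :=
    list_cons.comp ((fst.comp (snd.comp snd)).pair (const [])) (primrec_singleton.comp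
      ((primrec_int_neg.comp (hs.comp (snd.comp snd))).pair hn))
  exact list_cons.comp (h₁.pair (const [])) (list_cons.comp ((const [(1, [])]).pair h₂)
    (primrec_singleton.comp ((const [(1, [])]).pair h₃)))

theorem primrec_mapConstraint {d D i : α → ℕ} {n : α → List ℕ} (t s s' : ℕ) (hd : Primrec d)
    (hD : Primrec D) (hi : Primrec i) (hn : Primrec n) :
    Primrec fun a => mapConstraint (d a) (D a) t s s' (i a) (n a) := by
  refine Primrec.pair (list_append.comp (list_map (primrec_words.comp hd hD) ?_) ?_) (const [])
  · refine (const 1).pair (list_cons.comp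
      (primrec_name (const t) (hi.comp fst) snd) (list_map snd ?_))
    exact primrec_name (const s) snd (hn.comp (fst.comp fst))
  · exact primrec_singleton.comp ((const (-1)).pair
      (primrec_singleton.comp (primrec_name (const s') hi hn)))

theorem primrec_loopConstraint {d i : α → ℕ} {p : α → PolyCode AlgCode} {n : α → List ℕ}
    (s s' : ℕ) (hd : Primrec d) (hp : Primrec p) (hi : Primrec i) (hn : Primrec n) :
    Primrec fun a => loopConstraint (d a) s s' (p a) (i a) (n a) := by
  refine Primrec.pair (list_append.comp (list_map hp ?_) ?_) (const [])
  · refine (const 1).pair (list_cons.comp (primrec_algName.comp (fst.comp snd))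
      (list_flatMap (list_range.comp (hd.comp fst)) ?_))
    exact primrec_list_replicate.comp ((list_getD 0).comp (snd.comp (snd.comp fst)) snd)
      (primrec_name (const s) snd (hn.comp (fst.comp fst)))
  · exact primrec_singleton.comp ((const (-1)).pair
      (primrec_singleton.comp (primrec_name (const s') hi hn)))

theorem primrec_pointConstraint : Primrec₂ pointConstraint := by
  refine Primrec.pair (list_cons.comp ((const 1).pair (primrec_singleton.comp
    (primrec_name (const _) fst snd))) (primrec_singleton.comp (Primrec.pair ?_ (const []))))
    (const [])
  exact primrec_int_neg.comp (primrec_int_ofNat.comp ((list_getD 0).comp snd fst))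

theorem primrec_twnConstraint :
    Primrec fun x : ℕ × List ℕ × ℕ => twnConstraint x.1 x.2.1 x.2.2 := by
  refine Primrec.pair (primrec_singleton.comp ((const 1).pair (primrec_singleton.comp
    (primrec_name (const _) fst (fst.comp snd))))) (Primrec.ite ?_ (const _) ?_)
  · exact (Primrec.eq.comp (snd.comp snd) fst).and
      (nat_le.comp (list_length.comp (fst.comp snd)) (const 1))
  · exact list_cons.comp ((const 1).pair (primrec_singleton.comp
      (primrec_name (const _) fst (const [])))) (primrec_singleton.comp ((const (-1)).pair
        (primrec_singleton.comp (primrec_name (const _) (snd.comp snd) (const [])))))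

theorem primrec_loopDeg : Primrec loopDeg :=
  primrec_list_sum_nat.comp (list_map (list_flatten.comp (fst.comp snd))
    (primrec_list_sum_nat.comp (snd.comp snd)).to₂)

theorem primrec_invDeg : Primrec₂ invDeg :=
  nat_mul.comp fst (primrec_nat_pow.comp
    (nat_mul.comp (Primrec.succ.comp fst) (Primrec.succ.comp snd)) fst)

theorem primrec_updDeg : Primrec updDeg :=
  nat_mul.comp snd (nat_mul.comp (primrec_loopDeg.comp fst)
    (primrec_invDeg.comp (fst.comp fst) snd))

theorem primrec_gridSize : Primrec gridSize :=
  Primrec.succ.comp (nat_add.comp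
    (nat_mul.comp snd (primrec_invDeg.comp (fst.comp fst) snd)) primrec_updDeg)

theorem primrec_gridConstraints : Primrec fun x : (LoopCode × ℕ) × ℕ × List ℕ =>
    gridConstraints x.1 x.2.1 x.2.2 := by
  have hd : Primrec fun x : (LoopCode × ℕ) × ℕ × List ℕ => x.1.1.1 := fst.comp (fst.comp fst)
  have hδ : Primrec fun x : (LoopCode × ℕ) × ℕ × List ℕ => x.1.2 := snd.comp fst
  have hD := primrec_invDeg.comp hd hδ
  have hU : Primrec fun x : (LoopCode × ℕ) × ℕ × List ℕ => updDeg x.1 := primrec_updDeg.comp fst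
  have hi : Primrec fun x : (LoopCode × ℕ) × ℕ × List ℕ => x.2.1 := fst.comp snd
  have hn : Primrec fun x : (LoopCode × ℕ) × ℕ × List ℕ => x.2.2 := snd.comp snd
  have hp : Primrec fun x : (LoopCode × ℕ) × ℕ × List ℕ => x.1.1.2.1.getD x.2.1 [] :=
    (list_getD []).comp (fst.comp (snd.comp (fst.comp fst))) hi
  exact list_cons.comp (primrec_pointConstraint.comp hi hn) <|
    list_cons.comp (primrec_mapConstraint _ _ _ hd hD hi hn) <|
    list_cons.comp (primrec_mapConstraint _ _ _ hd hδ hi hn) <|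
    list_cons.comp (primrec_mapConstraint _ _ _ hd hδ hi hn) <|
    list_cons.comp (primrec_mapConstraint _ _ _ hd hD hi hn) <|
    list_cons.comp (primrec_loopConstraint _ _ hd hp hi hn) <|
    list_cons.comp (primrec_mapConstraint _ _ _ hd hδ hi hn) <|
    primrec_singleton.comp (primrec_mapConstraint _ _ _ hd hU hi hn)

theorem primrec_system : Primrec system := by
  have hd : Primrec fun x : LoopCode × ℕ => List.range x.1.1 :=
    list_range.comp (fst.comp fst)
  have hp : Primrec gridPoints :=
    primrec_words.comp (Primrec.succ.comp primrec_gridSize) (fst.comp fst)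
  have hw : Primrec fun x : LoopCode × ℕ => words x.1.1 (updDeg x) :=
    primrec_words.comp (fst.comp fst) primrec_updDeg
  have h₁ : Primrec₂ fun (x : LoopCode × ℕ) (i : ℕ) =>
      (gridPoints x).flatMap (gridConstraints x i) := by
    have h : Primrec₂ fun (y : (LoopCode × ℕ) × ℕ) (n : List ℕ) => gridConstraints y.1 y.2 n :=
      Primrec.comp (f := fun x : (LoopCode × ℕ) × ℕ × List ℕ => gridConstraints x.1 x.2.1 x.2.2)
        (g := fun y : ((LoopCode × ℕ) × ℕ) × List ℕ => (y.1.1, y.1.2, y.2))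
        primrec_gridConstraints ((fst.comp fst).pair ((snd.comp fst).pair snd))
    exact list_flatMap (hp.comp fst) h
  have h₂ : Primrec₂ fun (x : LoopCode × ℕ) (i : ℕ) =>
      (words x.1.1 (updDeg x)).flatMap fun u => u.map (twnConstraint i u) := by
    have h : Primrec₂ fun (y : (LoopCode × ℕ) × ℕ) (u : List ℕ) =>
        u.map (twnConstraint y.2 u) := by
      have h' : Primrec₂ fun (z : ((LoopCode × ℕ) × ℕ) × List ℕ) (j : ℕ) =>
          twnConstraint z.1.2 z.2 j :=
        Primrec.comp (f := fun x : ℕ × List ℕ × ℕ => twnConstraint x.1 x.2.1 x.2.2)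
          (g := fun z : (((LoopCode × ℕ) × ℕ) × List ℕ) × ℕ => (z.1.1.2, z.1.2, z.2))
          primrec_twnConstraint ((snd.comp (fst.comp fst)).pair ((snd.comp fst).pair snd))
      exact list_map snd h'
    exact list_flatMap (hw.comp fst) h
  have h₃ : Primrec fun x : LoopCode × ℕ => x.1.2.1.flatten.flatMap fun m => algConstraints m.1 :=
    list_flatMap (list_flatten.comp (fst.comp (snd.comp fst)))
      (primrec_algConstraints.comp (fst.comp snd)).to₂
  exact list_append.comp (list_flatMap hd h₁) (list_append.comp (list_flatMap hd h₂) h₃)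

theorem primrec_numVars : Primrec numVars := by
  refine Primrec.succ.comp (primrec_list_sum_nat.comp (list_map (list_flatMap Primrec.id ?_)
    (Primrec.encode.comp snd).to₂))
  exact list_flatMap (list_append.comp (fst.comp snd) (snd.comp snd)) (snd.comp snd).to₂

theorem primrec_toPolyCode : Primrec₂ NPoly.toPolyCode := by
  refine list_map snd (((fst.comp snd).pair (const 0)).pair
    (list_map (list_range.comp (fst.comp fst)) ?_))
  exact primrec_list_count_encode.comp (snd.comp (snd.comp fst)) snd

theorem primrec_toWord : Primrec₂ Constraint.toWord := by
  have h₁ : Primrec fun x : ℕ × Constraint => x.2.1.toPolyCode x.1 :=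
    primrec_toPolyCode.comp fst (fst.comp snd)
  have h₂ : Primrec fun x : ℕ × Constraint => x.2.2.toPolyCode x.1 :=
    primrec_toPolyCode.comp fst (snd.comp snd)
  exact list_cons.comp (const _) <| list_cons.comp (const _) <|
    list_cons.comp ((const 0).pair h₁) <| list_cons.comp (const _) <|
    list_cons.comp ((const 1).pair h₁) <| primrec_singleton.comp ((const 1).pair h₂)

theorem primrec_systemWord : Primrec₂ systemWord := by
  have h : Primrec₂ fun (x : ℕ × List Constraint) (y : Constraint × FormulaCode RatCode) =>
      ((3, []) :: (y.1.toWord x.1 ++ y.2) : FormulaCode RatCode) :=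
    list_cons.comp (const _) (list_append.comp
      (primrec_toWord.comp (fst.comp fst) (fst.comp snd)) (snd.comp snd))
  exact list_foldr snd (const [(0, [])]) h

theorem primrec_reduction : Primrec reduction :=
  (primrec_numVars.comp primrec_system).pair
    (primrec_systemWord.comp (primrec_numVars.comp primrec_system) primrec_system)

end Primrec

/-! ### Degree bound for the inverse of an automorphism -/

section Degree

open MvPolynomial

variable {K : Type*} {d : ℕ}

theorem totalDegree_aeval_le [CommRing K] {σ τ : Type*} (g : σ → MvPolynomial τ K)
    (p : MvPolynomial σ K) {D : ℕ} (hg : ∀ i, (g i).totalDegree ≤ D) :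
    (aeval g p).totalDegree ≤ p.totalDegree * D := by
  rw [aeval_def, eval₂_eq]
  refine totalDegree_finsetSum_le fun m hm => ?_
  refine (totalDegree_mul _ _).trans ?_
  rw [algebraMap_eq, totalDegree_C, zero_add]
  refine (totalDegree_finsetProd _ _).trans ?_
  calc ∑ i ∈ m.support, (g i ^ m i).totalDegree ≤ ∑ i ∈ m.support, m i * D :=
        Finset.sum_le_sum fun i _ => (totalDegree_pow _ _).trans (Nat.mul_le_mul_left _ (hg i))
    _ = (∑ i ∈ m.support, m i) * D := by rw [Finset.sum_mul]
    _ ≤ p.totalDegree * D := Nat.mul_le_mul_right _ (le_totalDegree hm)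

/-- An element of a domain that is a root of a nonzero polynomial divides some nonzero coefficient
of it. -/
theorem exists_dvd_coeff_of_eval_eq_zero {A : Type*} [CommRing A] [IsDomain A] {g : A} (hg : g ≠ 0)
    (n : ℕ) (Q : Polynomial A) (hn : Q.natDegree ≤ n) (hQ : Q ≠ 0) (h : Q.eval g = 0) :
    ∃ a, Q.coeff a ≠ 0 ∧ g ∣ Q.coeff a := by
  induction n generalizing Q with
  | zero =>
    rw [Polynomial.eq_C_of_natDegree_le_zero hn, Polynomial.eval_C] at h
    exact absurd (by rw [Polynomial.eq_C_of_natDegree_le_zero hn, h, map_zero]) hQ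
  | succ n ih =>
    have hd : Q.divX * Polynomial.X + Polynomial.C (Q.coeff 0) = Q := Q.divX_mul_X_add
    have he : Q.divX.eval g * g + Q.coeff 0 = 0 := by
      have := congrArg (Polynomial.eval g) hd
      simpa [h] using this
    by_cases h0 : Q.coeff 0 = 0
    · have h1 : Q.divX.eval g = 0 := by simpa [h0, hg] using he
      have h2 : Q.divX ≠ 0 := fun h2 => hQ (by rw [← hd, h0, h2]; simp)
      obtain ⟨a, ha, hga⟩ := ih Q.divX
        (by rw [Polynomial.natDegree_divX_eq_natDegree_tsub_one]; omega) h2 h1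
      exact ⟨a + 1, by simpa using ha, by simpa using hga⟩
    · exact ⟨0, h0, ⟨-Q.divX.eval g, by linear_combination he⟩⟩

/-- Too many polynomials of bounded degree are linearly dependent. -/
theorem exists_linear_relation [Field K] {E : Type*} [Fintype E] (M : ℕ)
    (v : E → MvPolynomial (Fin d) K) (hv : ∀ e, (v e).totalDegree ≤ M)
    (hcard : (M + 1) ^ d < Fintype.card E) :
    ∃ c : E → K, c ≠ 0 ∧ ∑ e, c e • v e = 0 := by
  let Φ : (E → K) →ₗ[K] ((Fin d → Fin (M + 1)) → K) :=
    LinearMap.pi fun m => (lcoeff K (Finsupp.equivFunOnFinite.symm fun i => (m i : ℕ))) ∘ₗ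
      Fintype.linearCombination K v
  have hΦ : LinearMap.ker Φ ≠ ⊥ := LinearMap.ker_ne_bot_of_finrank_lt (by simpa using hcard)
  obtain ⟨c, hc, hc0⟩ := (Submodule.ne_bot_iff _).1 hΦ
  refine ⟨c, hc0, ?_⟩
  ext m
  rw [coeff_zero]
  by_cases hm : ∀ i, m i ≤ M
  · have h := congrFun (LinearMap.mem_ker.1 hc) fun i => ⟨m i, Nat.lt_succ_of_le (hm i)⟩
    have hm' : (Finsupp.equivFunOnFinite.symm fun i => m i) = m := by ext; simp
    simpa [Φ, Fintype.linearCombination_apply, hm', coeff_sum] using h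
  · push Not at hm
    obtain ⟨i, hi⟩ := hm
    refine coeff_eq_zero_of_totalDegree_lt ?_
    have h1 : (∑ e, c e • v e).totalDegree ≤ M :=
      totalDegree_finsetSum_le fun e _ => (totalDegree_smul_le _ _).trans (hv e)
    have h2 : m i ≤ ∑ j ∈ m.support, m j :=
      Finset.single_le_sum (f := m) (fun _ _ => Nat.zero_le _) (by simp; omega)
    omega

/-- Between `x_i` and the `η (x_j)` there is a polynomial relation whose degree is bounded by a
dimension count. The inverse of `η` turns it into a polynomial relation between `η⁻¹ (x_i)` and the
variables, so that `η⁻¹ (x_i)` divides a nonzero polynomial of bounded degree. -/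
theorem totalDegree_symm_le [Field K] (η : MvPolynomial (Fin d) K ≃ₐ[K] MvPolynomial (Fin d) K)
    {δ : ℕ} (hη : ∀ j, (η (X j)).totalDegree ≤ δ) (i : Fin d) :
    (η.symm (X i)).totalDegree ≤ invDeg d δ := by
  -- this `N` makes the dimension count work: the monomials with exponents at most `N` in
  -- `d + 1` unknowns outnumber those with exponents at most `(d + 1) * (δ + 1) * N` in `d` unknowns
  set N := ((d + 1) * (δ + 1)) ^ d with hN
  set g := η.symm (X i) with hg
  by_cases hg0 : g = 0
  · simp [hg0]
  let v : Fin (N + 1) × (Fin d → Fin (N + 1)) → MvPolynomial (Fin d) K := fun e =>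
    X i ^ (e.1 : ℕ) * ∏ j, η (X j) ^ (e.2 j : ℕ)
  have hv : ∀ e, (v e).totalDegree ≤ (d + 1) * (δ + 1) * N := by
    intro e
    refine (totalDegree_mul _ _).trans ?_
    have h1 : (X i ^ (e.1 : ℕ) : MvPolynomial (Fin d) K).totalDegree ≤ (δ + 1) * N := by
      rw [totalDegree_X_pow]
      nlinarith [e.1.is_lt, Nat.zero_le (δ * N)]
    have h2 : (∏ j, η (X j) ^ (e.2 j : ℕ)).totalDegree ≤ d * ((δ + 1) * N) := by
      refine (totalDegree_finsetProd _ _).trans ?_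
      refine (Finset.sum_le_card_nsmul _ _ ((δ + 1) * N) fun j _ => ?_).trans (by simp)
      refine (totalDegree_pow _ _).trans ?_
      have := (e.2 j).is_lt
      calc (e.2 j : ℕ) * (η (X j)).totalDegree ≤ N * (δ + 1) :=
            Nat.mul_le_mul (by omega) ((hη j).trans (Nat.le_succ _))
        _ = _ := Nat.mul_comm _ _
    calc _ ≤ (δ + 1) * N + d * ((δ + 1) * N) := Nat.add_le_add h1 h2
      _ = _ := by ring
  have hcard : ((d + 1) * (δ + 1) * N + 1) ^ d
      < Fintype.card (Fin (N + 1) × (Fin d → Fin (N + 1))) := by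
    simp only [Fintype.card_prod, Fintype.card_fin, Fintype.card_fun]
    have h1 : (d + 1) * (δ + 1) * N + 1 ≤ (d + 1) * (δ + 1) * (N + 1) := by
      have : 0 < (d + 1) * (δ + 1) := by positivity
      nlinarith
    calc _ ≤ ((d + 1) * (δ + 1) * (N + 1)) ^ d := Nat.pow_le_pow_left h1 d
      _ = N * (N + 1) ^ d := by rw [mul_pow, ← hN]
      _ < _ := Nat.mul_lt_mul_of_pos_right (Nat.lt_succ_self N) (by positivity)
  obtain ⟨c, hc0, hc⟩ := exists_linear_relation _ v hv hcard
  -- the relation, transported by `η⁻¹`, is `Q (g) = 0` with `Q = ∑ a, P a * T ^ a`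
  let P : Fin (N + 1) → MvPolynomial (Fin d) K := fun a =>
    ∑ e : Fin d → Fin (N + 1),
      monomial (Finsupp.equivFunOnFinite.symm fun j => (e j : ℕ)) (c (a, e))
  have hPc : ∀ a e, (P a).coeff (Finsupp.equivFunOnFinite.symm fun j => (e j : ℕ)) = c (a, e) := by
    intro a e
    simp only [P, coeff_sum, coeff_monomial]
    rw [Finset.sum_eq_single e]
    · simp
    · intro e' _ he'
      rw [if_neg]
      intro h
      apply he'
      ext j
      simpa using DFunLike.congr_fun h j
    · simp
  let Q : Polynomial (MvPolynomial (Fin d) K) := ∑ a : Fin (N + 1), Polynomial.monomial a (P a)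
  have hQc : ∀ n, Q.coeff n = if h : n < N + 1 then P ⟨n, h⟩ else 0 := by
    intro n
    simp only [Q, Polynomial.finsetSum_coeff, Polynomial.coeff_monomial]
    split_ifs with h
    · rw [Finset.sum_eq_single ⟨n, h⟩]
      · simp
      · intro a _ ha
        exact if_neg fun h' => ha (Fin.ext h')
      · simp
    · refine Finset.sum_eq_zero fun a _ => if_neg ?_
      have := a.is_lt
      omega
  have hQ0 : Q ≠ 0 := by
    obtain ⟨⟨a, e⟩, hae⟩ := Function.ne_iff.1 hc0
    intro h
    apply hae
    have h1 : P a = 0 := by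
      have := hQc a
      rw [h, dif_pos a.is_lt] at this
      simpa using this.symm
    rw [← hPc, h1]
    simp
  have hQg : Q.eval g = 0 := by
    have h1 := congrArg η.symm hc
    rw [map_sum, map_zero, Fintype.sum_prod_type] at h1
    rw [← h1]
    simp only [Q, Polynomial.eval_finsetSum, Polynomial.eval_monomial, P, Finset.sum_mul]
    refine Finset.sum_congr rfl fun a _ => Finset.sum_congr rfl fun e _ => ?_
    simp only [v, map_smul, map_mul, map_pow, map_prod, AlgEquiv.symm_apply_apply, ← hg]
    rw [monomial_eq, Finsupp.prod_fintype _ _ (by simp), smul_eq_C_mul]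
    simp only [Finsupp.equivFunOnFinite_symm_apply_apply]
    ring
  obtain ⟨n, hn, hdvd⟩ := exists_dvd_coeff_of_eval_eq_zero hg0 _ Q le_rfl hQ0 hQg
  rw [hQc] at hn hdvd
  split_ifs at hn hdvd with h
  · obtain ⟨r, hr⟩ := hdvd
    have hr0 : r ≠ 0 := by rintro rfl; exact hn (by rw [hr, mul_zero])
    have h1 : (P ⟨n, h⟩).totalDegree ≤ d * N := by
      refine totalDegree_finsetSum_le fun e _ => (totalDegree_monomial_le _ _).trans ?_
      rw [Finsupp.sum_fintype _ _ (by simp)]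
      refine (Finset.sum_le_card_nsmul _ _ N fun j _ => ?_).trans (by simp)
      have := (e j).is_lt
      simp
      omega
    rw [hr, totalDegree_mul_of_isDomain hg0 hr0] at h1
    exact (Nat.le_add_right _ _).trans h1
  · exact absurd rfl hn

/-- A polynomial is determined by its values on a sufficiently large grid. -/
theorem eq_of_eval_eq_on_grid [Field K] [CharZero K] {p q : MvPolynomial (Fin d) K} {B : ℕ}
    (hp : p.totalDegree ≤ B) (hq : q.totalDegree ≤ B)
    (h : ∀ n : Fin d → ℕ, (∀ i, n i ≤ B) →
      eval (fun i => (n i : K)) p = eval (fun i => (n i : K)) q) : p = q := by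
  rw [← sub_eq_zero]
  refine eq_zero_of_eval_zero_at_prod_finset _
    (fun _ => (Finset.range (B + 1)).map Nat.castEmbedding) (fun i => ?_) fun x hx => ?_
  · rw [Finset.card_map, Finset.card_range]
    refine Nat.lt_succ_of_le ((degreeOf_le_totalDegree _ _).trans ?_)
    exact (totalDegree_sub _ _).trans (max_le hp hq)
  · simp only [Finset.mem_map, Finset.mem_range, Nat.castEmbedding_apply] at hx
    choose n hn hx using hx
    have hx' : x = fun i => (n i : K) := funext fun i => (hx i).symm
    rw [map_sub, hx', h n fun i => Nat.le_of_lt_succ (hn i), sub_self]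

end Degree

/-! ### Polynomials given by coefficients of words -/

theorem mem_words {k n : ℕ} {u : List ℕ} : u ∈ words k n ↔ u.length ≤ n ∧ ∀ j ∈ u, j < k := by
  induction n generalizing u with
  | zero => cases u <;> simp [words]
  | succ n ih => cases u with
    | nil => simp [words]
    | cons j u => simp [words, ih]; tauto

theorem nodup_words (k n : ℕ) : (words k n).Nodup := by
  induction n with
  | zero => simp [words]
  | succ n ih =>
    simp only [words, List.nodup_cons]
    refine ⟨by simp, List.nodup_flatMap.2 ⟨fun i _ => ih.map fun a b h => by simpa using h, ?_⟩⟩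
    refine List.nodup_range.pairwise_of_forall_ne fun i _ j _ hij => ?_
    intro u hu hu'
    simp only [List.mem_map] at hu hu'
    obtain ⟨a, -, rfl⟩ := hu
    obtain ⟨b, -, hb⟩ := hu'
    exact hij (List.cons.inj hb).1.symm

/-- The exponent vector of the monomial `x_u` that is written as a word `u`. -/
noncomputable def wordExp (d : ℕ) (u : List ℕ) : Fin d →₀ ℕ :=
  Finsupp.equivFunOnFinite.symm fun i => u.count (i : ℕ)

theorem wordExp_apply (d : ℕ) (u : List ℕ) (i : Fin d) : wordExp d u i = u.count (i : ℕ) := rfl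

theorem wordExp_ne_zero {d : ℕ} {u : List ℕ} {i : Fin d} : wordExp d u i ≠ 0 ↔ (i : ℕ) ∈ u := by
  simp [wordExp_apply, List.count_eq_zero]

theorem wordExp_cons {d : ℕ} (i : Fin d) (u : List ℕ) :
    wordExp d ((i : ℕ) :: u) = Finsupp.single i 1 + wordExp d u := by
  ext j
  simp [wordExp_apply, List.count_cons, Finsupp.single_apply, Fin.ext_iff, add_comm]

theorem degree_wordExp {d : ℕ} {u : List ℕ} (hu : ∀ j ∈ u, j < d) :
    (wordExp d u).degree = u.length := by
  induction u with
  | nil =>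
    have : wordExp d [] = 0 := by ext; simp [wordExp_apply]
    simp [this]
  | cons j u ih =>
    rw [List.forall_mem_cons] at hu
    rw [show j = ((⟨j, hu.1⟩ : Fin d) : ℕ) from rfl, wordExp_cons, map_add, ih hu.2]
    simp [add_comm]

theorem exists_wordExp_eq {d : ℕ} (m : Fin d →₀ ℕ) :
    ∃ u : List ℕ, wordExp d u = m ∧ ∀ j ∈ u, j < d := by
  refine ⟨(Finsupp.toMultiset m).toList.map Fin.val, ?_, by simp⟩
  ext i
  rw [wordExp_apply, List.count_map_of_injective _ _ Fin.val_injective, ← Multiset.coe_count,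
    Multiset.coe_toList, Finsupp.count_toMultiset]

section

open MvPolynomial

variable {K : Type*} [CommRing K]

/-- The polynomial `∑ u, c_u * x_u`, where `u` ranges over the words of length at most `D`. -/
noncomputable def wordPoly (d D : ℕ) (c : List ℕ → K) : MvPolynomial (Fin d) K :=
  ((words d D).map fun u => monomial (wordExp d u) (c u)).sum

theorem wordPoly_eq_sum (d D : ℕ) (c : List ℕ → K) :
    wordPoly d D c = ∑ u ∈ (words d D).toFinset, monomial (wordExp d u) (c u) :=
  (List.sum_toFinset _ (nodup_words d D)).symm

theorem totalDegree_monomial_le_degree {d : ℕ} (m : Fin d →₀ ℕ) (a : K) :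
    (monomial m a).totalDegree ≤ m.degree :=
  (totalDegree_monomial_le _ _).trans (by rw [Finsupp.degree_apply]; rfl)

theorem totalDegree_wordPoly_le (d D : ℕ) (c : List ℕ → K) :
    (wordPoly d D c).totalDegree ≤ D := by
  rw [wordPoly_eq_sum]
  refine totalDegree_finsetSum_le fun u hu => (totalDegree_monomial_le_degree _ _).trans ?_
  obtain ⟨h₁, h₂⟩ := mem_words.1 (List.mem_toFinset.1 hu)
  rwa [degree_wordExp h₂]

theorem exists_word_of_mem_support {d D : ℕ} {c : List ℕ → K} {m : Fin d →₀ ℕ}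
    (hm : m ∈ (wordPoly d D c).support) : ∃ u ∈ words d D, c u ≠ 0 ∧ wordExp d u = m := by
  by_contra! h
  rw [mem_support_iff, wordPoly_eq_sum, coeff_sum] at hm
  refine hm (Finset.sum_eq_zero fun u hu => ?_)
  rw [coeff_monomial]
  split_ifs with hum
  · by_contra hc
    exact h u (List.mem_toFinset.1 hu) hc hum
  · rfl

/-- Each polynomial is given by coefficients of words, and no word needs to be used that denotes a
monomial outside of the support. -/
theorem exists_wordPoly_eq {d D : ℕ} (p : MvPolynomial (Fin d) K) (hp : p.totalDegree ≤ D) :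
    ∃ c : List ℕ → K, wordPoly d D c = p ∧ ∀ u, c u ≠ 0 → wordExp d u ∈ p.support := by
  classical
  choose w hw hwd using exists_wordExp_eq (d := d)
  refine ⟨fun u => ∑ m ∈ p.support with w m = u, p.coeff m, ?_, fun u hu => ?_⟩
  · rw [wordPoly_eq_sum]
    have h : ∀ m ∈ p.support, w m ∈ (words d D).toFinset := fun m hm => by
      rw [List.mem_toFinset, mem_words]
      refine ⟨?_, hwd m⟩
      rw [← degree_wordExp (hwd m), hw, Finsupp.degree_apply]
      exact (le_totalDegree hm).trans hp
    conv_rhs => rw [← support_sum_monomial_coeff p]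
    rw [← Finset.sum_fiberwise_of_maps_to h]
    refine Finset.sum_congr rfl fun u _ => ?_
    rw [map_sum]
    refine Finset.sum_congr rfl fun m hm => ?_
    rw [← (Finset.mem_filter.1 hm).2, hw]
  · obtain ⟨m, hm, -⟩ := Finset.exists_ne_zero_of_sum_ne_zero hu
    obtain ⟨h₁, rfl⟩ := Finset.mem_filter.1 hm
    rwa [hw]

theorem eval_wordPoly (d D : ℕ) (c : List ℕ → K) (x : ℕ → K) :
    eval (fun i : Fin d => x i) (wordPoly d D c) =
      ((words d D).map fun u => c u * (u.map x).prod).sum := by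
  rw [wordPoly, map_list_sum, List.map_map]
  refine congrArg List.sum (List.map_congr_left fun u hu => ?_)
  have hu' := (mem_words.1 hu).2
  clear hu
  rw [Function.comp_apply, eval_monomial]
  congr 1
  induction u with
  | nil =>
    have : wordExp d [] = 0 := by ext; simp [wordExp_apply]
    simp [this]
  | cons j u ih =>
    rw [List.forall_mem_cons] at hu'
    rw [List.map_cons, List.prod_cons, ← ih hu'.2]
    conv_lhs => rw [show j = ((⟨j, hu'.1⟩ : Fin d) : ℕ) from rfl, wordExp_cons]
    rw [Finsupp.prod_add_index' (by simp) (by simp [pow_add])]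
    simp

theorem eval_aeval {σ τ : Type*} (x : τ → K) (g : σ → MvPolynomial τ K) (p : MvPolynomial σ K) :
    eval x (aeval g p) = eval (fun i => eval x (g i)) p := by
  induction p using MvPolynomial.induction_on with
  | C a => simp
  | add p q hp hq => rw [map_add, map_add, map_add, hp, hq]
  | mul_X p i hp => rw [map_mul, map_mul, map_mul, hp, aeval_X, eval_X]

theorem sum_map_eq_sum_get {α M : Type*} [AddCommMonoid M] (l : List α) (f : α → M) :
    (l.map f).sum = ∑ j : Fin l.length, f (l.get j) := by
  rw [← List.sum_ofFn]
  congr 1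
  exact (List.ofFn_getElem_eq_map l f).symm

theorem eval_monomial_exponents {d : ℕ} (l : List ℕ) (a : K) (x : ℕ → K) :
    eval (fun i : Fin d => x i) (monomial (exponents d l) a) =
      a * (((List.range d).flatMap fun i => List.replicate (l.getD i 0) i).map x).prod := by
  rw [eval_monomial, Finsupp.prod_fintype _ _ (by simp), List.map_flatMap, List.flatMap_def,
    List.prod_flatten, List.map_map, ← List.prod_toFinset _ List.nodup_range, List.toFinset_range,
    Finset.prod_range]
  simp [exponents]

end

/-! ### Meaning of the constraints -/

section

open MvPolynomial

variable {K : Type} [Field K] [LinearOrder K]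

theorem sat_mapConstraint {d D t s s' i : ℕ} {n : List ℕ} {y : Name → K} :
    (mapConstraint d D t s s' i n).Sat y ↔
      eval (fun l : Fin d => y (s, l, n)) (wordPoly d D fun u => y (t, i, u)) = y (s', i, n) := by
  rw [eval_wordPoly d D _ fun l => y (s, l, n)]
  simp only [mapConstraint, Constraint.Sat, NPoly.eval_append, NPoly.eval_cons, NPoly.eval_nil,
    lt_irrefl, or_false]
  rw [← sub_eq_zero (b := y (s', i, n))]
  simp [NPoly.eval, Function.comp_def, sub_eq_add_neg]

theorem sat_pointConstraint {i : ℕ} {n : List ℕ} {y : Name → K} :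
    (pointConstraint i n).Sat y ↔ y (tagPt, i, n) = (n.getD i 0 : ℕ) := by
  simp [pointConstraint, Constraint.Sat, ← sub_eq_add_neg, sub_eq_zero]

theorem sat_twnConstraint [IsStrictOrderedRing K] {i j : ℕ} {u : List ℕ} {y : Name → K} :
    (twnConstraint i u j).Sat y ↔ y (tagUpd, i, u) = 0 ∨ (j = i ∧ u.length ≤ 1) ∨
      y (tagRank, j, []) < y (tagRank, i, []) := by
  rw [twnConstraint, Constraint.Sat]
  by_cases h : j = i ∧ u.length ≤ 1
  · simp [h]
  · simp [h, ← sub_eq_add_neg]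

theorem sat_loopConstraint {d s s' i : ℕ} {n : List ℕ} {y : Name → K} {r : AlgCode → K → Prop}
    {p : PolyCode AlgCode} {P : MvPolynomial (Fin d) K} (hp : PolyCode.Denotes r p P)
    (hy : ∀ m ∈ p, ∀ α, r m.1 α → y (algName m.1) = α) :
    (loopConstraint d s s' p i n).Sat y ↔
      eval (fun l : Fin d => y (s, l, n)) P = y (s', i, n) := by
  obtain ⟨α, hα, rfl⟩ := hp
  simp only [loopConstraint, Constraint.Sat, NPoly.eval_append, NPoly.eval_cons, NPoly.eval_nil,
    lt_irrefl, or_false]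
  rw [← sub_eq_zero (b := y (s', i, n)), map_sum]
  simp only [eval_monomial_exponents _ _ fun l => y (s, l, n)]
  simp only [NPoly.eval, List.map_map, sum_map_eq_sum_get]
  rw [sub_eq_add_neg]
  refine Eq.congr_left ?_
  congr 1
  · refine Finset.sum_congr rfl fun j _ => ?_
    have := hy _ (List.get_mem p j) _ (hα j)
    simp [← this, List.map_flatMap]
  · simp

end

theorem sat_algConstraints {c : AlgCode} {y : Name → RealAlg} :
    (∀ C ∈ algConstraints c, C.Sat y) ↔ c.IsRoot (y (algName c)) := by
  have hlt : ∀ (q : RatCode) (x : RealAlg),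
      (((q.2 + 1 : ℕ) : ℤ) : RealAlg) * x - q.1 =
        ((q.2 : RealAlg) + 1) * (x - (q.val : RealAlg)) := by
    intro q x
    have : (q.2 : RealAlg) + 1 ≠ 0 := by positivity
    rw [RatCode.val]
    push_cast
    field_simp
  have hpos : ∀ q : RatCode, (0 : RealAlg) < (q.2 : RealAlg) + 1 := fun q => by positivity
  have h₁ := hlt c.2.1 (y (algName c))
  have h₂ := hlt c.2.2 (y (algName c))
  have e₁ : 0 < (((c.2.1.2 + 1 : ℕ) : ℤ) : RealAlg) * y (algName c) - c.2.1.1 ↔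
      (c.2.1.val : RealAlg) < y (algName c) := by
    rw [h₁, mul_pos_iff_of_pos_left (hpos _), sub_pos]
  have e₂ : 0 < (c.2.2.1 : RealAlg) - (((c.2.2.2 + 1 : ℕ) : ℤ) : RealAlg) * y (algName c) ↔
      y (algName c) < (c.2.2.val : RealAlg) := by
    rw [← neg_sub, neg_pos, h₂, mul_neg_iff]
    simp [hpos, (hpos c.2.2).not_gt]
  have e₃ : NPoly.eval y ((List.range c.1.length).map fun j =>
      (c.1.getD j 0, List.replicate j (algName c))) =
      ∑ j : Fin c.1.length, (c.1.get j : RealAlg) * y (algName c) ^ (j : ℕ) := by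
    rw [NPoly.eval, List.map_map, ← List.sum_toFinset _ List.nodup_range, List.toFinset_range,
      Finset.sum_range]
    simp
  rw [AlgCode.IsRoot, ← e₁, ← e₂, ← e₃]
  simp only [algConstraints, List.forall_mem_cons, Constraint.Sat, NPoly.eval_cons, NPoly.eval_nil,
    List.map_cons, List.map_nil, List.prod_cons, List.prod_nil, mul_one, Int.cast_one, add_zero,
    one_ne_zero, false_or, lt_irrefl, or_false, Int.cast_neg, neg_mul, ← sub_eq_add_neg]
  simp only [List.not_mem_nil, IsEmpty.forall_iff, implies_true, and_true]
  tauto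

/-! ### Meaning of the existential formula -/

section

open MvPolynomial

namespace PropFormula

theorem rel_map {P Q : Type} {r : P → Q → Prop} {f : P → Q} (h : ∀ p, r p (f p))
    (φ : PropFormula P) : Rel r φ (φ.map f) := by
  induction φ with
  | ge p => exact h p
  | gt p => exact h p
  | neg φ ih => exact ih
  | and φ ψ h₁ h₂ => exact ⟨h₁, h₂⟩
  | or φ ψ h₁ h₂ => exact ⟨h₁, h₂⟩

theorem holds_map {P Q K : Type} [Zero K] [LE K] [LT K] (f : P → Q) (val : Q → K)
    (φ : PropFormula P) : (φ.map f).Holds val ↔ φ.Holds fun p => val (f p) := by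
  induction φ with
  | ge p => rfl
  | gt p => rfl
  | neg φ ih => exact not_congr ih
  | and φ ψ h₁ h₂ => exact and_congr h₁ h₂
  | or φ ψ h₁ h₂ => exact or_congr h₁ h₂

end PropFormula

/-- The polynomial with the given code. -/
noncomputable def PolyCode.toPoly (k : ℕ) (c : PolyCode RatCode) : MvPolynomial (Fin k) ℚ :=
  ∑ j, monomial (exponents k (c.get j).2) (c.get j).1.val

theorem PolyCode.denotes_toPoly (k : ℕ) (c : PolyCode RatCode) :
    PolyCode.Denotes (fun (q : RatCode) (x : ℚ) => q.val = x) c (c.toPoly k) :=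
  ⟨fun j => (c.get j).1.val, fun _ => rfl, rfl⟩

theorem prod_pow_count {K : Type*} [CommRing K] {k : ℕ} (y : Fin k → K) (y' : Name → K)
    {l : List Name} (hy : ∀ v ∈ l, ∃ h : Encodable.encode v < k, y ⟨Encodable.encode v, h⟩ = y' v) :
    ∏ i : Fin k, y i ^ (l.map Encodable.encode).count (i : ℕ) = (l.map y').prod := by
  induction l with
  | nil => simp
  | cons v l ih =>
    rw [List.forall_mem_cons] at hy
    obtain ⟨⟨h, hv⟩, hl⟩ := hy
    rw [List.map_cons, List.map_cons, List.prod_cons, ← ih hl, ← hv]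
    generalize Encodable.encode v = e at h ⊢
    simp only [List.count_cons, pow_add, Finset.prod_mul_distrib]
    rw [mul_comm]
    congr 1
    rw [Finset.prod_eq_single ⟨e, h⟩]
    · simp
    · intro i _ hi
      rw [if_neg, pow_zero]
      exact fun he => hi (Fin.ext (beq_iff_eq.1 he).symm)
    · simp

theorem aeval_toPoly_toPolyCode {k : ℕ} (y : Fin k → RealAlg) (y' : Name → RealAlg) {p : NPoly}
    (hy : ∀ m ∈ p, ∀ v ∈ m.2,
      ∃ h : Encodable.encode v < k, y ⟨Encodable.encode v, h⟩ = y' v) :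
    aeval y ((p.toPolyCode k).toPoly k) = p.eval y' := by
  rw [PolyCode.toPoly, ← sum_map_eq_sum_get (p.toPolyCode k)
    fun m => monomial (exponents k m.2) m.1.val, NPoly.toPolyCode, List.map_map, map_list_sum,
    List.map_map, NPoly.eval]
  refine congrArg List.sum (List.map_congr_left fun m hm => ?_)
  simp only [Function.comp_apply, aeval_monomial, RatCode.val_int]
  rw [← prod_pow_count y y' (hy m hm), Finsupp.prod_fintype _ _ (by simp)]
  simp [exponents]

theorem holds_toFormula {k : ℕ} (y : Fin k → RealAlg) (y' : Name → RealAlg) {C : Constraint}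
    (hy : ∀ m ∈ C.1 ++ C.2, ∀ v ∈ m.2,
      ∃ h : Encodable.encode v < k, y ⟨Encodable.encode v, h⟩ = y' v) :
    (C.toFormula k).Holds (fun p => aeval y (p.toPoly k)) ↔ C.Sat y' := by
  simp only [Constraint.toFormula, PropFormula.Holds]
  rw [aeval_toPoly_toPolyCode y y' fun m hm => hy m (List.mem_append_left _ hm),
    aeval_toPoly_toPolyCode y y' fun m hm => hy m (List.mem_append_right _ hm), not_lt,
    Constraint.Sat, le_antisymm_iff, and_comm]

theorem holds_systemFormula {k : ℕ} (y : Fin k → RealAlg) (y' : Name → RealAlg)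
    {S : List Constraint} (hy : ∀ C ∈ S, ∀ m ∈ C.1 ++ C.2, ∀ v ∈ m.2,
      ∃ h : Encodable.encode v < k, y ⟨Encodable.encode v, h⟩ = y' v) :
    (systemFormula k S).Holds (fun p => aeval y (p.toPoly k)) ↔ ∀ C ∈ S, C.Sat y' := by
  induction S with
  | nil => simp [systemFormula, PropFormula.Holds, PolyCode.toPoly]
  | cons C S ih =>
    rw [List.forall_mem_cons] at hy ⊢
    exact and_congr (holds_toFormula y y' hy.1) (ih hy.2)

theorem encode_lt_numVars {S : List Constraint} {C : Constraint} (hC : C ∈ S)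
    {m : ℤ × List Name} (hm : m ∈ C.1 ++ C.2) {v : Name} (hv : v ∈ m.2) :
    Encodable.encode v < numVars S := by
  refine Nat.lt_succ_of_le (List.single_le_sum (fun _ _ => Nat.zero_le _) _ ?_)
  refine List.mem_map_of_mem (List.mem_flatMap.2 ⟨C, hC, List.mem_flatMap.2 ⟨m, hm, hv⟩⟩)

/-- The existential closure of the conjunction of a system of constraints. -/
noncomputable def systemSentence (S : List Constraint) : ExSentence where
  k := numVars S
  matrix := (systemFormula (numVars S) S).map (PolyCode.toPoly (numVars S))

theorem denotes_systemSentence (S : List Constraint) :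
    ExCode.Denotes (numVars S, systemWord (numVars S) S) (systemSentence S) :=
  ⟨rfl, _, word_systemFormula _ S, PropFormula.rel_map (PolyCode.denotes_toPoly _) _⟩

theorem valid_systemSentence (S : List Constraint) :
    (systemSentence S).Valid ↔ ∃ y : Name → RealAlg, ∀ C ∈ S, C.Sat y := by
  simp only [ExSentence.Valid, systemSentence, PropFormula.holds_map]
  constructor
  · rintro ⟨y, hy⟩
    refine ⟨fun v => if h : Encodable.encode v < numVars S then y ⟨_, h⟩ else 0, ?_⟩
    refine (holds_systemFormula y _ fun C hC m hm v hv => ?_).1 hy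
    exact ⟨encode_lt_numVars hC hm hv, by rw [dif_pos (encode_lt_numVars hC hm hv)]⟩
  · rintro ⟨y, hy⟩
    refine ⟨fun i => ((Encodable.decode (i : ℕ) : Option Name).map y).getD 0, ?_⟩
    refine (holds_systemFormula _ y fun C hC m hm v hv => ?_).2 hy
    exact ⟨encode_lt_numVars hC hm hv, by rw [Encodable.encodek]; rfl⟩

end

/-! ### Correctness of the constraint system -/

section

open MvPolynomial

variable {d : ℕ}

theorem mem_gridPoints {x : LoopCode × ℕ} {n : Fin x.1.1 → ℕ} (hn : ∀ i, n i ≤ gridSize x) :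
    List.ofFn n ∈ gridPoints x := by
  rw [gridPoints, mem_words]
  refine ⟨by simp, fun j hj => ?_⟩
  obtain ⟨i, rfl⟩ := (List.mem_ofFn' _ _).1 hj
  exact Nat.lt_succ_of_le (hn i)

theorem forall_mem_system {x : LoopCode × ℕ} {p : Constraint → Prop} :
    (∀ C ∈ system x, p C) ↔
      (∀ i < x.1.1, ∀ n ∈ gridPoints x, ∀ C ∈ gridConstraints x i n, p C) ∧
      (∀ i < x.1.1, ∀ u ∈ words x.1.1 (updDeg x), ∀ j ∈ u, p (twnConstraint i u j)) ∧
      ∀ m ∈ x.1.2.1.flatten, ∀ C ∈ algConstraints m.1, p C := by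
  simp only [system, List.forall_mem_append, List.forall_mem_flatMap, List.mem_range,
    List.forall_mem_map]

theorem degree_exponents_le (d : ℕ) (l : List ℕ) : (exponents d l).degree ≤ l.sum := by
  rw [Finsupp.degree_eq_sum]
  simp only [exponents, Finsupp.equivFunOnFinite_symm_apply_apply]
  induction l generalizing d with
  | nil => simp
  | cons a l ih => cases d with
    | zero => simp
    | succ d =>
      rw [Fin.sum_univ_succ, List.sum_cons]
      exact Nat.add_le_add_left (ih d) a

theorem totalDegree_le_loopDeg {K : Type} [CommRing K] {r : AlgCode → K → Prop} {c : LoopCode}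
    {p : PolyCode AlgCode} (hp : p ∈ c.2.1) {P : MvPolynomial (Fin d) K}
    (h : PolyCode.Denotes r p P) : P.totalDegree ≤ loopDeg c := by
  obtain ⟨α, -, rfl⟩ := h
  refine totalDegree_finsetSum_le fun j _ => (totalDegree_monomial_le_degree _ _).trans ?_
  refine (degree_exponents_le _ _).trans (List.single_le_sum (fun _ _ => Nat.zero_le _) _ ?_)
  exact List.mem_map_of_mem (f := fun m : AlgCode × List ℕ => m.2.sum)
    (List.mem_flatten.2 ⟨p, hp, List.get_mem p j⟩)

/-- The number of successors with respect to `≻` is a rank function. -/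
theorem card_succ_lt {L : Loop RealAlg d} (hL : L.Triangular) {i j : Fin d}
    (h : L.Succ i j) : Nat.card {k // L.Succ j k} < Nat.card {k // L.Succ i k} := by
  refine Set.ncard_lt_ncard (s := {k | L.Succ j k}) (t := {k | L.Succ i k}) ⟨fun k hk => ?_, ?_⟩
  · exact Relation.TransGen.trans h hk
  · intro hs
    exact (hL.irrefl).irrefl j (hs h)

/-- A satisfying assignment yields an automorphism: the unknown coefficients define polynomials
`f`, `g` and `b`, and the constraints on the grid are polynomial identities which say that the
substitutions by `f` and `g` are inverse to each other, and that `b` is the transformed update. -/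
theorem exists_aut_of_sat {L : Loop RealAlg d} {c : LoopCode} (hc : c.Denotes L) {δ : ℕ}
    {y : Name → RealAlg} (hy : ∀ C ∈ system (c, δ), C.Sat y) :
    ∃ η : PolyAut RealAlg d, η.deg ≤ δ ∧ (L.Tr η).IsTwn := by
  obtain ⟨rfl, ⟨hlen, hupd⟩, -⟩ := hc
  rw [forall_mem_system] at hy
  obtain ⟨hgrid, htwn, halg⟩ := hy
  let f : Fin c.1 → MvPolynomial (Fin c.1) RealAlg := fun i =>
    wordPoly c.1 δ fun u => y (tagAut, i, u)
  let g : Fin c.1 → MvPolynomial (Fin c.1) RealAlg := fun i =>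
    wordPoly c.1 (invDeg c.1 δ) fun u => y (tagInv, i, u)
  let b : Fin c.1 → MvPolynomial (Fin c.1) RealAlg := fun i =>
    wordPoly c.1 (updDeg (c, δ)) fun u => y (tagUpd, i, u)
  have hf : ∀ i, (f i).totalDegree ≤ δ := fun i => totalDegree_wordPoly_le _ _ _
  have hg : ∀ i, (g i).totalDegree ≤ invDeg c.1 δ := fun i => totalDegree_wordPoly_le _ _ _
  have hb : ∀ i, (b i).totalDegree ≤ updDeg (c, δ) := fun i => totalDegree_wordPoly_le _ _ _
  have hget : ∀ i : Fin c.1, c.2.1.getD i [] = c.2.1.get (i.cast hlen.symm) := fun i => by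
    simp [List.getD_eq_getElem?_getD, hlen]
  have hmem : ∀ i : Fin c.1, c.2.1.get (i.cast hlen.symm) ∈ c.2.1 := fun i => List.get_mem _ _
  have ha : ∀ i, (L.update i).totalDegree ≤ loopDeg c := fun i =>
    totalDegree_le_loopDeg (hmem i) (hupd i)
  -- the unknowns for the coefficients of the loop have the intended values
  have hval : ∀ i : Fin c.1, ∀ m ∈ c.2.1.get (i.cast hlen.symm), ∀ α,
      AlgCode.Denotes m.1 α → y (algName m.1) = α := fun i m hm α hα =>
    hα.2 _ (sat_algConstraints.1 (halg m (List.mem_flatten.2 ⟨_, hmem i, hm⟩)))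
  have hB₁ : δ * invDeg c.1 δ ≤ gridSize (c, δ) := by simp only [gridSize]; omega
  have hB₂ : updDeg (c, δ) ≤ gridSize (c, δ) := by simp only [gridSize]; omega
  have hX : ∀ i : Fin c.1, (X i : MvPolynomial (Fin c.1) RealAlg).totalDegree ≤ gridSize (c, δ) :=
    fun i => by rw [totalDegree_X]; simp only [gridSize]; omega
  -- what the constraints say about a single grid point
  have key : ∀ n : Fin c.1 → ℕ, (∀ i, n i ≤ gridSize (c, δ)) → ∀ i,
      eval (fun l => (n l : RealAlg)) (aeval g (f i)) = n i ∧
      eval (fun l => (n l : RealAlg)) (aeval f (g i)) = n i ∧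
      eval (fun l => (n l : RealAlg)) (aeval g (aeval L.update (f i))) =
        eval (fun l => (n l : RealAlg)) (b i) := by
    intro n hn
    have hC := fun i : Fin c.1 => hgrid i i.is_lt (List.ofFn n) (mem_gridPoints hn)
    simp only [gridConstraints, List.forall_mem_cons, sat_mapConstraint, sat_pointConstraint,
      hget] at hC
    have hpt : ∀ i : Fin c.1, y (tagPt, i, List.ofFn n) = n i := fun i => by
      rw [(hC i).1]
      simp [List.getD_eq_getElem?_getD]
    have hloop : ∀ i : Fin c.1, eval (fun l : Fin c.1 => y (tagPtInv, l, List.ofFn n)) (L.update i)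
        = y (tagPtLoop, i, List.ofFn n) := fun i =>
      (sat_loopConstraint (hupd i) (hval i)).1 (hC i).2.2.2.2.2.1
    simp only [hpt] at hC
    have hPtInv : ∀ l : Fin c.1, eval (fun l => (n l : RealAlg)) (g l) =
        y (tagPtInv, l, List.ofFn n) := fun l => (hC l).2.1
    have hPtAut : ∀ l : Fin c.1, eval (fun l => (n l : RealAlg)) (f l) =
        y (tagPtAut, l, List.ofFn n) := fun l => (hC l).2.2.2.1
    intro i
    refine ⟨?_, ?_, ?_⟩
    · rw [eval_aeval]
      simp only [hPtInv]
      exact (hC i).2.2.1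
    · rw [eval_aeval]
      simp only [hPtAut]
      exact (hC i).2.2.2.2.1
    · rw [eval_aeval, eval_aeval]
      simp only [hPtInv, hloop]
      exact (hC i).2.2.2.2.2.2.1.trans (hC i).2.2.2.2.2.2.2.1.symm
  have hgf : ∀ i, aeval g (f i) = X i := fun i => by
    refine eq_of_eval_eq_on_grid (((totalDegree_aeval_le g _ hg).trans
      (Nat.mul_le_mul_right _ (hf i))).trans hB₁) (hX i) fun n hn => ?_
    rw [(key n hn i).1, eval_X]
  have hfg : ∀ i, aeval f (g i) = X i := fun i => by
    refine eq_of_eval_eq_on_grid (((totalDegree_aeval_le f _ hf).trans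
      (Nat.mul_le_mul_right _ (hg i))).trans ?_) (hX i) fun n hn => ?_
    · rwa [mul_comm]
    · rw [(key n hn i).2.1, eval_X]
  have hbi : ∀ i, aeval g (aeval L.update (f i)) = b i := fun i => by
    refine eq_of_eval_eq_on_grid (((totalDegree_aeval_le g _ hg).trans
      (Nat.mul_le_mul_right _ ((totalDegree_aeval_le _ _ ha).trans
        (Nat.mul_le_mul_right _ (hf i))))).trans ?_) ((hb i).trans hB₂)
        fun n hn => (key n hn i).2.2
    rw [mul_assoc]
    exact hB₂
  let η : PolyAut RealAlg c.1 := AlgEquiv.ofAlgHom (aeval f) (aeval g)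
    (algHom_ext fun i => by rw [AlgHom.comp_apply, aeval_X, hfg]; rfl)
    (algHom_ext fun i => by rw [AlgHom.comp_apply, aeval_X, hgf]; rfl)
  have hη : ∀ i, η (X i) = f i := fun i => aeval_X _ _
  have hTr : ∀ i, (L.Tr η).update i = b i := fun i => by
    rw [← hbi]
    simp only [Loop.Tr, hη]
    rfl
  -- a monomial of `b i` stems from a word whose coefficient does not vanish
  have hsupp : ∀ i : Fin c.1, ∀ m ∈ ((L.Tr η).update i).support, ∀ j : Fin c.1, m j ≠ 0 →
      (j = i ∧ m.degree ≤ 1) ∨ y (tagRank, j, []) < y (tagRank, i, []) := by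
    intro i m hm j hj
    rw [hTr] at hm
    obtain ⟨u, hu, hu0, rfl⟩ := exists_word_of_mem_support hm
    have h := htwn i i.is_lt u hu j (wordExp_ne_zero.1 hj)
    rw [sat_twnConstraint] at h
    rw [degree_wordExp (mem_words.1 hu).2, Fin.ext_iff]
    exact h.resolve_left hu0
  refine ⟨η, Finset.sup_le fun i _ => by rw [hη]; exact hf i, ?_, ?_⟩
  · have hlt : ∀ i j, (L.Tr η).Succ i j → y (tagRank, j, []) < y (tagRank, i, []) := by
      have h1 : ∀ i j : Fin c.1, i ≠ j ∧ j ∈ ((L.Tr η).update i).vars →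
          y (tagRank, j, []) < y (tagRank, i, []) := by
        rintro i j ⟨hij, hj⟩
        obtain ⟨m, hm, hmj⟩ := (mem_vars_iff_mem_support j).1 hj
        exact (hsupp i m hm j (Finsupp.mem_support_iff.1 hmj)).resolve_left fun h => hij h.1.symm
      intro i j h
      induction h with
      | single h => exact h1 _ _ h
      | tail _ h ih => exact (h1 _ _ h).trans ih
    have hi : Std.Irrefl fun j i => (L.Tr η).Succ i j := ⟨fun i h => lt_irrefl _ (hlt i i h)⟩
    have ht : IsTrans _ fun j i => (L.Tr η).Succ i j :=
      ⟨fun _ _ _ h₁ h₂ => Relation.TransGen.trans h₂ h₁⟩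
    exact Finite.wellFounded_of_trans_of_irrefl _
  · intro i m hm hmi
    exact ((hsupp i m hm i hmi).resolve_right (lt_irrefl _)).2

/-- The extension of a family that is indexed by `Fin d` to all natural numbers by zero. -/
noncomputable def extend {β : Type*} [Zero β] (F : Fin d → β) (i : ℕ) : β :=
  if h : i < d then F ⟨i, h⟩ else 0

@[simp] theorem extend_val {β : Type*} [Zero β] (F : Fin d → β) (i : Fin d) :
    extend F i = F i := dif_pos i.is_lt

open Classical in
/-- The number with the given code, and `0` if there is no such number. -/
noncomputable def algValue (c : AlgCode) : RealAlg :=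
  if h : ∃ α, c.Denotes α then h.choose else 0

theorem algValue_eq {c : AlgCode} {α : RealAlg} (h : c.Denotes α) : algValue c = α := by
  have h' : ∃ α, c.Denotes α := ⟨α, h⟩
  rw [algValue, dif_pos h']
  exact h.2 _ h'.choose_spec.1

/-- The assignment that is given by the coefficients of `η (x_i)`, of `η⁻¹ (x_i)` and of the
transformed update, by the values at the grid points, by ranks and by the coefficients of the
loop. The cases are in the order of the tags. -/
noncomputable def assignment (cf cg cb : Fin d → List ℕ → RealAlg)
    (pInv pAut pLoop pUpd : List ℕ → Fin d → RealAlg) (rank : Fin d → RealAlg) :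
    Name → RealAlg := fun v =>
  match v.1 with
  | 0 => extend cf v.2.1 v.2.2
  | 1 => extend cg v.2.1 v.2.2
  | 2 => extend cb v.2.1 v.2.2
  | 3 => ((v.2.2.getD v.2.1 0 : ℕ) : RealAlg)
  | 4 => extend (pInv v.2.2) v.2.1
  | 5 => extend (pAut v.2.2) v.2.1
  | 6 => extend (pLoop v.2.2) v.2.1
  | 7 => extend (pUpd v.2.2) v.2.1
  | 8 => extend rank v.2.1
  | _ => ((Encodable.decode v.2.1 : Option AlgCode).map algValue).getD 0

theorem algEquiv_apply_eq_aeval {K σ : Type*} [CommRing K]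
    (φ : MvPolynomial σ K ≃ₐ[K] MvPolynomial σ K) (p : MvPolynomial σ K) :
    φ p = aeval (fun i => φ (X i)) p := by
  induction p using MvPolynomial.induction_on with
  | C a => rw [← algebraMap_eq, AlgEquiv.commutes, AlgHom.commutes]
  | add p q hp hq => rw [map_add, map_add, hp, hq]
  | mul_X p i hp => rw [map_mul, map_mul, hp, aeval_X]

/-- An automorphism yields a satisfying assignment. -/
theorem exists_sat_of_aut {L : Loop RealAlg d} {c : LoopCode} (hc : c.Denotes L) {δ : ℕ}
    {η : PolyAut RealAlg d} (hδ : η.deg ≤ δ) (hη : (L.Tr η).IsTwn) :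
    ∃ y : Name → RealAlg, ∀ C ∈ system (c, δ), C.Sat y := by
  obtain ⟨rfl, ⟨hlen, hupd⟩, -⟩ := hc
  have hf : ∀ i, (η (X i)).totalDegree ≤ δ := fun i =>
    (Finset.le_sup (f := fun i => (η (X i)).totalDegree) (Finset.mem_univ i)).trans hδ
  have hg : ∀ i, (η.symm (X i)).totalDegree ≤ invDeg c.1 δ := totalDegree_symm_le η hf
  have hget : ∀ i : Fin c.1, c.2.1.getD i [] = c.2.1.get (i.cast hlen.symm) := fun i => by
    simp [List.getD_eq_getElem?_getD, hlen]
  have hmem : ∀ i : Fin c.1, c.2.1.get (i.cast hlen.symm) ∈ c.2.1 := fun i => List.get_mem _ _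
  have ha : ∀ i, (L.update i).totalDegree ≤ loopDeg c := fun i =>
    totalDegree_le_loopDeg (hmem i) (hupd i)
  have hsymm : ∀ p, η.symm p = aeval (fun i => η.symm (X i)) p := 
    algEquiv_apply_eq_aeval η.symm
  have happ : ∀ p, η p = aeval (fun i => η (X i)) p := 
    algEquiv_apply_eq_aeval η
  have hTr : ∀ i, (L.Tr η).update i =
      aeval (fun i => η.symm (X i)) (aeval L.update (η (X i))) := fun i => hsymm _
  have hb : ∀ i, ((L.Tr η).update i).totalDegree ≤ updDeg (c, δ) := fun i => by
    rw [hTr]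
    refine (totalDegree_aeval_le _ _ hg).trans ?_
    rw [updDeg, ← mul_assoc]
    exact Nat.mul_le_mul_right _ ((totalDegree_aeval_le _ _ ha).trans
      (Nat.mul_le_mul_right _ (hf i)))
  choose cf hcf _ using fun i => exists_wordPoly_eq _ (hf i)
  choose cg hcg _ using fun i => exists_wordPoly_eq _ (hg i)
  choose cb hcb hcb' using fun i => exists_wordPoly_eq _ (hb i)
  let pt : List ℕ → Fin c.1 → RealAlg := fun n l => (n.getD l 0 : ℕ)
  let pInv : List ℕ → Fin c.1 → RealAlg := fun n l => eval (pt n) (η.symm (X l))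
  let pLoop : List ℕ → Fin c.1 → RealAlg := fun n l => eval (pInv n) (L.update l)
  let y := assignment cf cg cb pInv (fun n l => eval (pt n) (η (X l))) pLoop
    (fun n l => eval (pLoop n) (η (X l))) fun i => (Nat.card {k // (L.Tr η).Succ i k} : RealAlg)
  have hval : ∀ a α, AlgCode.Denotes a α → y (algName a) = α := by
    intro a α hα
    have e : y (algName a) =
        ((Encodable.decode (Encodable.encode a) : Option AlgCode).map algValue).getD 0 := rfl
    rw [e, Encodable.encodek, Option.map_some, Option.getD_some, algValue_eq hα]
  refine ⟨y, forall_mem_system.2 ⟨fun i hi n _ => ?_, fun i hi u hu j hj => ?_, fun m hm => ?_⟩⟩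
  · obtain ⟨i, rfl⟩ : ∃ i' : Fin c.1, (i' : ℕ) = i := ⟨⟨i, hi⟩, rfl⟩
    simp only [gridConstraints, List.forall_mem_cons, sat_mapConstraint, sat_pointConstraint,
      hget, sat_loopConstraint (hupd i) fun m _ α => hval m.1 α]
    simp only [y, assignment, extend_val]
    simp only [hcf, hcg, hcb]
    refine ⟨trivial, rfl, ?_, rfl, ?_, rfl, trivial, ?_, by simp⟩
    · change eval (fun l => eval (pt n) (η.symm (X l))) (η (X i)) = _
      rw [← eval_aeval, ← hsymm, AlgEquiv.symm_apply_apply, eval_X]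
    · rw [← eval_aeval, ← happ, AlgEquiv.apply_symm_apply, eval_X]
    · rw [hTr, eval_aeval, eval_aeval]
  · obtain ⟨i, rfl⟩ : ∃ i' : Fin c.1, (i' : ℕ) = i := ⟨⟨i, hi⟩, rfl⟩
    obtain ⟨j, rfl⟩ : ∃ j' : Fin c.1, (j' : ℕ) = j := ⟨⟨j, (mem_words.1 hu).2 j hj⟩, rfl⟩
    rw [sat_twnConstraint]
    simp only [y, assignment, extend_val]
    by_cases hu0 : cb i u = 0
    · exact Or.inl hu0
    · have hm := hcb' i u hu0
      have hmj : wordExp c.1 u j ≠ 0 := wordExp_ne_zero.2 hj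
      by_cases hij : i = j
      · subst hij
        have h := hη.2 i _ hm hmj
        rw [degree_wordExp (mem_words.1 hu).2] at h
        exact Or.inr (Or.inl ⟨rfl, h⟩)
      · refine Or.inr (Or.inr (Nat.cast_lt.2 (card_succ_lt hη.1 ?_)))
        exact Relation.TransGen.single
          ⟨hij, (mem_vars_iff_mem_support j).2 ⟨_, hm, Finsupp.mem_support_iff.2 hmj⟩⟩
  · rw [sat_algConstraints]
    obtain ⟨p, hp, hm⟩ := List.mem_flatten.1 hm
    obtain ⟨i, rfl⟩ := List.mem_iff_get.1 hp
    obtain ⟨j, rfl⟩ := List.mem_iff_get.1 hm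
    obtain ⟨α, hα, -⟩ := hupd (i.cast hlen)
    have h : AlgCode.Denotes ((c.2.1.get i).get j).1 (α j) := hα j
    rw [hval _ _ h]
    exact h.1

theorem exists_sat_system_iff {L : Loop RealAlg d} {c : LoopCode} (hc : c.Denotes L) (δ : ℕ) :
    (∃ y : Name → RealAlg, ∀ C ∈ system (c, δ), C.Sat y) ↔
      ∃ η : PolyAut RealAlg d, η.deg ≤ δ ∧ (L.Tr η).IsTwn :=
  ⟨fun ⟨_, hy⟩ => exists_aut_of_sat hc hy, fun ⟨_, hδ, hη⟩ => exists_sat_of_aut hc hδ hη⟩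

end

/-! ### Certificates for satisfiability -/

/-- Certificates for the satisfiability of a system: a polynomial `f`, two rational points between
which `f` has a root `θ`, polynomials in `θ` for the values of the unknowns, and pairs `(s, h)` that
witness the single constraints. -/
abbrev Certificate : Type := UPoly × RatCode × RatCode × List UPoly × List (UPoly × UPoly)

/-- The result of substituting univariate polynomials for the names; the list `q` is indexed by the
codes of the names. -/
def NPoly.evalUPoly (q : List UPoly) (p : NPoly) : UPoly :=
  p.foldr (fun m r => UPoly.add (UPoly.mul [(m.1, 0)]
    (m.2.foldr (fun v s => UPoly.mul (q.getD (Encodable.encode v) []) s) [(1, 0)])) r) []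

open Polynomial in
theorem NPoly.toPoly_evalUPoly (q : List UPoly) (p : NPoly) :
    UPoly.toPoly (p.evalUPoly q) =
      p.eval fun v => UPoly.toPoly (q.getD (Encodable.encode v) []) := by
  have h : ∀ l : List Name, UPoly.toPoly
      (l.foldr (fun v s => UPoly.mul (q.getD (Encodable.encode v) []) s) [(1, 0)]) =
      (l.map fun v => UPoly.toPoly (q.getD (Encodable.encode v) [])).prod := by
    intro l
    induction l with
    | nil => simp [UPoly.toPoly]
    | cons v l ih => rw [List.foldr_cons, UPoly.toPoly_mul, ih, List.map_cons, List.prod_cons]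
  induction p with
  | nil => rfl
  | cons m p ih =>
    rw [NPoly.eval_cons, ← ih, ← h]
    simp only [NPoly.evalUPoly, List.foldr_cons, UPoly.toPoly_add, UPoly.toPoly_mul, UPoly.toPoly]
    simp

/-- The identity `p * (q * s ^ 2 - 1) + f * h = 0`, where `(p, q)` is the constraint. At a root of
`f` it implies `p = 0` or `q * s ^ 2 = 1`. -/
def Witnesses (w : Certificate) (C : Constraint) (t : UPoly × UPoly) : Prop :=
  UPoly.IsZero (UPoly.add (UPoly.mul (C.1.evalUPoly w.2.2.2.1)
    (UPoly.add (UPoly.mul (C.2.evalUPoly w.2.2.2.1) (UPoly.mul t.1 t.1)) [(-1, 0)]))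
    (UPoly.mul w.1 t.2))

/-- The certificate proves that the system is satisfiable. -/
def Certifies (S : List Constraint) (w : Certificate) : Prop :=
  ((UPoly.eval w.2.1 w.1).1 < 0 ∧ 0 < (UPoly.eval w.2.2.1 w.1).1) ∧
    ∀ C ∈ S, ∃ t ∈ w.2.2.2.2, Witnesses w C t

open Polynomial in
theorem witnesses_iff {w : Certificate} {C : Constraint} {t : UPoly × UPoly} :
    Witnesses w C t ↔
      C.1.eval (fun v => UPoly.toPoly (w.2.2.2.1.getD (Encodable.encode v) [])) *
        (C.2.eval (fun v => UPoly.toPoly (w.2.2.2.1.getD (Encodable.encode v) [])) *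
          UPoly.toPoly t.1 ^ 2 - 1) + UPoly.toPoly w.1 * UPoly.toPoly t.2 = 0 := by
  rw [Witnesses, UPoly.isZero_iff]
  simp only [UPoly.toPoly_add, UPoly.toPoly_mul, NPoly.toPoly_evalUPoly, UPoly.toPoly]
  simp [sq, ← sub_eq_add_neg]

section Primrec

open Primrec

theorem primrec_evalUPoly : Primrec₂ NPoly.evalUPoly := by
  have h₁ : Primrec₂ fun (x : List UPoly × List Name) (y : Name × UPoly) =>
      UPoly.mul (x.1.getD (Encodable.encode y.1) []) y.2 :=
    UPoly.primrec_mul.comp ((list_getD []).comp (fst.comp fst)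
      (Primrec.encode.comp (fst.comp snd))) (snd.comp snd)
  have h₂ : Primrec₂ fun (q : List UPoly) (l : List Name) =>
      l.foldr (fun v s => UPoly.mul (q.getD (Encodable.encode v) []) s) [(1, 0)] :=
    list_foldr snd (const [(1, 0)]) h₁
  have h₃ : Primrec₂ fun (x : List UPoly × NPoly) (y : (ℤ × List Name) × UPoly) =>
      UPoly.add (UPoly.mul [(y.1.1, 0)] (y.1.2.foldr
        (fun v s => UPoly.mul (x.1.getD (Encodable.encode v) []) s) [(1, 0)])) y.2 := by
    refine UPoly.primrec_add.comp (UPoly.primrec_mul.comp (primrec_singleton.comp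
      ((fst.comp (fst.comp snd)).pair (const 0))) ?_) (snd.comp snd)
    exact h₂.comp (fst.comp fst) (snd.comp (fst.comp snd))
  exact list_foldr snd (const []) h₃

theorem primrecRel_certifies : PrimrecRel Certifies := by
  have hq : Primrec fun w : Certificate => w.2.2.2.1 := fst.comp (snd.comp (snd.comp snd))
  have h₁ : PrimrecRel fun (t : UPoly × UPoly) (x : Constraint × Certificate) =>
      Witnesses x.2 x.1 t := by
    refine UPoly.primrecPred_isZero.comp (UPoly.primrec_add.comp (UPoly.primrec_mul.comp
      (primrec_evalUPoly.comp (hq.comp (snd.comp snd)) (fst.comp (fst.comp snd)))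
      (UPoly.primrec_add.comp (UPoly.primrec_mul.comp
        (primrec_evalUPoly.comp (hq.comp (snd.comp snd)) (snd.comp (fst.comp snd)))
        (UPoly.primrec_mul.comp (fst.comp fst) (fst.comp fst))) (const [(-1, 0)])))
      (UPoly.primrec_mul.comp (fst.comp (snd.comp snd)) (snd.comp fst)))
  have h₂ : PrimrecRel fun (C : Constraint) (w : Certificate) =>
      ∃ t ∈ w.2.2.2.2, Witnesses w C t :=
    h₁.exists_mem_list.comp (snd.comp (snd.comp (snd.comp (snd.comp snd)))) Primrec.id
  have h₃ : PrimrecPred fun w : Certificate =>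
      (UPoly.eval w.2.1 w.1).1 < 0 ∧ 0 < (UPoly.eval w.2.2.1 w.1).1 := by
    have ha : Primrec fun w : Certificate => (UPoly.eval w.2.1 w.1).1 :=
      fst.comp (UPoly.primrec_eval.comp (fst.comp snd) fst)
    have hb : Primrec fun w : Certificate => (UPoly.eval w.2.2.1 w.1).1 :=
      fst.comp (UPoly.primrec_eval.comp (fst.comp (snd.comp snd)) fst)
    refine ((nat_lt.comp (const 0) (primrec_int_toNat_neg.comp ha)).and
      (nat_lt.comp (const 0) (primrec_int_toNat.comp hb))).of_eq fun w => ?_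
    exact and_congr (by omega) (by omega)
  exact (h₃.comp snd).and h₂.forall_mem_list

/-- A projection of a primitive recursive relation is recursively enumerable. -/
theorem rePred_exists {α β : Type*} [Primcodable α] [Primcodable β] {R : α → β → Prop}
    (hR : PrimrecRel R) : REPred fun a => ∃ b, R a b := by
  classical
  have h₁ : Primrec₂ fun (a : α) (n : ℕ) =>
      ((Encodable.decode n : Option β).map fun b => decide (R a b)).getD false :=
    option_getD.comp (option_map (Primrec.decode.comp snd)
      (hR.decide.comp (fst.comp fst) snd).to₂) (const false)
  have h₂ : Partrec fun a : α => Nat.rfind fun n => Part.some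
      (((Encodable.decode n : Option β).map fun b => decide (R a b)).getD false) :=
    Partrec.rfind h₁.to_comp.partrec₂
  refine h₂.dom_re.of_eq fun a => ?_
  refine Nat.rfind_dom.trans ⟨?_, ?_⟩
  · rintro ⟨n, hn, -⟩
    replace hn := Part.mem_some_iff.1 hn
    cases hd : (Encodable.decode n : Option β) with
    | none => simp [hd] at hn
    | some b => exact ⟨b, by simpa [hd] using hn⟩
  · rintro ⟨b, hb⟩
    exact ⟨Encodable.encode b, Part.mem_some_iff.2 (by simpa using hb), fun _ => trivial⟩

end Primrec

section

open Polynomial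

theorem exists_mul_sq_eq_one {x : RealAlg} (hx : 0 < x) : ∃ s : RealAlg, x * s ^ 2 = 1 := by
  have hx' : (0 : ℝ) < x := hx
  have h : (√(x : ℝ)) ^ 2 = x := Real.sq_sqrt hx'.le
  have halg : IsAlgebraic ℚ √(x : ℝ) := by
    refine IsAlgebraic.of_pow two_pos ?_
    rw [h]
    exact mem_algebraicClosure_iff.1 x.2
  refine ⟨⟨√(x : ℝ), mem_algebraicClosure_iff.2 halg⟩⁻¹, Subtype.ext ?_⟩
  push_cast
  rw [inv_pow]
  change (x : ℝ) * ((√(x : ℝ)) ^ 2)⁻¹ = 1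
  rw [h, mul_inv_cancel₀ hx'.ne']

theorem isIntegral_realAlg (x : RealAlg) : IsIntegral ℚ x :=
  (isIntegral_algHom_iff (algebraicClosure ℚ ℝ).val Subtype.val_injective).1
    (mem_algebraicClosure_iff'.1 x.2)

theorem coe_aeval (θ : RealAlg) (p : ℚ[X]) : ((aeval θ p : RealAlg) : ℝ) = aeval (θ : ℝ) p :=
  (aeval_algHom_apply (algebraicClosure ℚ ℝ).val θ p).symm

/-- A rational polynomial that changes its sign has a real algebraic root. -/
theorem exists_root_of_sign_change {p : ℚ[X]} {a b : ℚ} (ha : p.eval a < 0) (hb : 0 < p.eval b) :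
    ∃ θ : RealAlg, aeval θ p = 0 := by
  have he : ∀ q : ℚ, aeval (q : ℝ) p = ((p.eval q : ℚ) : ℝ) := fun q => by
    have := aeval_algebraMap_apply_eq_algebraMap_eval (A := ℝ) q p
    simpa using this
  have hc : Continuous fun x : ℝ => aeval x p := p.continuous_aeval
  obtain ⟨x, hx⟩ : ∃ x : ℝ, aeval x p = 0 := by
    refine mem_range_of_exists_le_of_exists_ge hc ⟨a, ?_⟩ ⟨b, ?_⟩
    · rw [he]; exact_mod_cast ha.le
    · rw [he]; exact_mod_cast hb.le
  have hp : p ≠ 0 := by rintro rfl; simp at ha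
  refine ⟨⟨x, mem_algebraicClosure_iff.2 ⟨p, hp, hx⟩⟩, Subtype.ext ?_⟩
  rw [coe_aeval]
  exact hx

/-- Up to its sign, the minimal polynomial of a real algebraic number changes its sign there, since
it has only simple roots. -/
theorem exists_sign_change (θ : RealAlg) :
    ∃ (p : ℚ[X]) (a b : ℚ), p.eval a < 0 ∧ 0 < p.eval b ∧ ∀ q : ℚ[X], aeval θ q = 0 → p ∣ q := by
  have hint : IsIntegral ℚ θ := isIntegral_realAlg θ
  have hsep := (minpoly.irreducible hint).separable
  have hd : aeval θ (derivative (minpoly ℚ θ)) ≠ 0 :=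
    hsep.aeval_derivative_ne_zero (minpoly.aeval ℚ θ)
  obtain ⟨p, hp0, hpd, hdvd⟩ : ∃ p : ℚ[X], aeval θ p = 0 ∧ 0 < aeval θ (derivative p) ∧
      ∀ q : ℚ[X], aeval θ q = 0 → p ∣ q := by
    rcases hd.lt_or_gt with h | h
    · exact ⟨-minpoly ℚ θ, by simp, by simpa using h, fun q hq => by
        rw [neg_dvd]; exact minpoly.dvd ℚ θ hq⟩
    · exact ⟨minpoly ℚ θ, by simp, h, fun q hq => minpoly.dvd ℚ θ hq⟩
  have he : ∀ q : ℚ, aeval (q : ℝ) p = ((p.eval q : ℚ) : ℝ) := fun q => by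
    have := aeval_algebraMap_apply_eq_algebraMap_eval (A := ℝ) q p
    simpa using this
  have hpd' : 0 < deriv (fun x : ℝ => aeval x p) (θ : ℝ) := by
    rw [Polynomial.deriv_aeval, ← coe_aeval]
    exact hpd
  have hp0' : aeval (θ : ℝ) p = 0 := by rw [← coe_aeval, hp0]; rfl
  have hs := eventually_nhdsWithin_sign_eq_of_deriv_pos hpd' hp0'
  obtain ⟨ε, hε, hs⟩ := Metric.eventually_nhds_iff.1 hs
  obtain ⟨a, ha₁, ha₂⟩ := exists_rat_btwn (show (θ : ℝ) - ε < θ by linarith)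
  obtain ⟨b, hb₁, hb₂⟩ := exists_rat_btwn (show (θ : ℝ) < θ + ε by linarith)
  refine ⟨p, a, b, ?_, ?_, hdvd⟩
  · have := hs (y := a) (by rw [Real.dist_eq, abs_lt]; constructor <;> linarith)
    rw [sign_neg (sub_neg.2 ha₂), sign_eq_neg_one_iff, he] at this
    exact_mod_cast this
  · have := hs (y := b) (by rw [Real.dist_eq, abs_lt]; constructor <;> linarith)
    rw [sign_pos (sub_pos.2 hb₁), sign_eq_one_iff, he] at this
    exact_mod_cast this

/-- By the primitive element theorem, finitely many real algebraic numbers are rational polynomials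
in a single one. -/
theorem exists_primitive (T : Finset RealAlg) :
    ∃ θ : RealAlg, ∀ t ∈ T, ∃ q : ℚ[X], aeval θ q = t := by
  let K := IntermediateField.adjoin ℚ (T : Set RealAlg)
  have hK : FiniteDimensional ℚ K :=
    IntermediateField.finiteDimensional_adjoin fun x _ => isIntegral_realAlg x
  let pb := Field.powerBasisOfFiniteOfSeparable ℚ K
  refine ⟨pb.gen, fun t ht => ?_⟩
  obtain ⟨q, hq⟩ := pb.exists_eq_aeval' ⟨t, IntermediateField.subset_adjoin ℚ _ ht⟩
  refine ⟨q, ?_⟩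
  have := aeval_algHom_apply K.val pb.gen q
  rw [← hq] at this
  exact this

theorem NPoly.eval_congr {K : Type*} [CommRing K] {y y' : Name → K} {p : NPoly}
    (h : ∀ m ∈ p, ∀ v ∈ m.2, y v = y' v) : p.eval y = p.eval y' := by
  refine congrArg List.sum (List.map_congr_left fun m hm => ?_)
  rw [List.map_congr_left (h m hm)]

/-- Certificates are sound: the root of `f` that exists by the change of sign yields a satisfying
assignment. -/
theorem exists_sat_of_certifies {S : List Constraint} {w : Certificate} (h : Certifies S w) :
    ∃ y : Name → RealAlg, ∀ C ∈ S, C.Sat y := by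
  obtain ⟨⟨ha, hb⟩, hS⟩ := h
  rw [← RatCode.val_pos, UPoly.val_eval] at hb
  have ha' : (UPoly.toPoly w.1).eval w.2.1.val < 0 := by
    rw [← UPoly.val_eval, RatCode.val]
    exact div_neg_of_neg_of_pos (by exact_mod_cast ha) (by positivity)
  obtain ⟨θ, hθ⟩ := exists_root_of_sign_change ha' hb
  refine ⟨fun v => aeval θ (UPoly.toPoly (w.2.2.2.1.getD (Encodable.encode v) [])), fun C hC => ?_⟩
  obtain ⟨t, -, ht⟩ := hS C hC
  have h := congrArg ((aeval θ : ℚ[X] →ₐ[ℚ] RealAlg) : ℚ[X] →+* RealAlg) (witnesses_iff.1 ht)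
  rw [map_add, map_mul, map_sub, map_mul, map_mul, NPoly.map_eval, NPoly.map_eval, map_pow,
    map_one, map_zero, RingHom.coe_coe, hθ, zero_mul, add_zero, mul_eq_zero, sub_eq_zero] at h
  refine h.imp id fun h => ?_
  have h' := one_pos (α := RealAlg)
  rw [← h] at h'
  exact pos_of_mul_pos_left h' (sq_nonneg _)

/-- Certificates are complete: the values of the unknowns, and the numbers `s` with `q * s ^ 2 = 1`
for the strict inequations, are polynomials in a primitive element `θ`. -/
theorem exists_certifies_of_sat {S : List Constraint} {y : Name → RealAlg}
    (hy : ∀ C ∈ S, C.Sat y) : ∃ w, Certifies S w := by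
  classical
  have hs : ∀ C : Constraint, ∃ s : RealAlg, C ∈ S → C.1.eval y * (C.2.eval y * s ^ 2 - 1) = 0 := by
    intro C
    by_cases hC : C ∈ S
    · rcases hy C hC with h | h
      · exact ⟨0, fun _ => by rw [h, zero_mul]⟩
      · obtain ⟨s, hs⟩ := exists_mul_sq_eq_one h
        exact ⟨s, fun _ => by rw [hs, sub_self, mul_zero]⟩
    · exact ⟨0, fun h => absurd h hC⟩
  -- only the finitely many numbers `y v` for names `v` in the system and `s C` have to be expressed
  -- by a single number
  choose s hs using hs
  let names : List Name := S.flatMap fun C => (C.1 ++ C.2).flatMap Prod.snd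
  obtain ⟨θ, hθ⟩ := exists_primitive ((names.map y).toFinset ∪ (S.map s).toFinset)
  have hθy : ∀ v, ∃ q : ℚ[X], v ∈ names → aeval θ q = y v := fun v => by
    by_cases hv : v ∈ names
    · obtain ⟨q, hq⟩ := hθ (y v) (Finset.mem_union_left _
        (List.mem_toFinset.2 (List.mem_map_of_mem hv)))
      exact ⟨q, fun _ => hq⟩
    · exact ⟨0, fun h => absurd h hv⟩
  have hθs : ∀ C, ∃ q : ℚ[X], C ∈ S → aeval θ q = s C := fun C => by
    by_cases hC : C ∈ S
    · obtain ⟨q, hq⟩ := hθ (s C) (Finset.mem_union_right _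
        (List.mem_toFinset.2 (List.mem_map_of_mem hC)))
      exact ⟨q, fun _ => hq⟩
    · exact ⟨0, fun h => absurd h hC⟩
  -- `Q v` is the value of the unknown `v`, and `σ C` the number `s` for `C`, as polynomials in `θ`
  choose Q hQ using hθy
  choose σ hσ using hθs
  obtain ⟨p, a, b, ha, hb, hdvd⟩ := exists_sign_change θ
  have hdiv : ∀ C : Constraint, ∃ h : ℚ[X], C ∈ S →
      C.1.eval Q * (C.2.eval Q * σ C ^ 2 - 1) + p * h = 0 := by
    intro C
    by_cases hC : C ∈ S
    · have hname : ∀ m ∈ C.1 ++ C.2, ∀ v ∈ m.2, v ∈ names := fun m hm v hv =>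
        List.mem_flatMap.2 ⟨C, hC, List.mem_flatMap.2 ⟨m, hm, hv⟩⟩
      have h₁ : aeval θ (C.1.eval Q) = C.1.eval y :=
        (NPoly.map_eval ((aeval θ : ℚ[X] →ₐ[ℚ] RealAlg) : ℚ[X] →+* RealAlg) Q C.1).trans
          (NPoly.eval_congr fun m hm v hv => hQ v (hname m (List.mem_append_left _ hm) v hv))
      have h₂ : aeval θ (C.2.eval Q) = C.2.eval y :=
        (NPoly.map_eval ((aeval θ : ℚ[X] →ₐ[ℚ] RealAlg) : ℚ[X] →+* RealAlg) Q C.2).trans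
          (NPoly.eval_congr fun m hm v hv => hQ v (hname m (List.mem_append_right _ hm) v hv))
      obtain ⟨h, hh⟩ := hdvd (C.1.eval Q * (C.2.eval Q * σ C ^ 2 - 1)) (by
        rw [map_mul, map_sub, map_mul, map_pow, map_one, h₁, h₂, hσ C hC, hs C hC])
      exact ⟨-h, fun _ => by rw [hh]; ring⟩
    · exact ⟨0, fun h => absurd h hC⟩
  choose H hH using hdiv
  choose code hcode using UPoly.exists_toPoly_eq
  choose rat hrat using RatCode.exists_val_eq
  let q : List UPoly := (List.range (numVars S)).map fun n =>
    ((Encodable.decode n : Option Name).map fun v => code (Q v)).getD []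
  have hq : ∀ C ∈ S, ∀ m ∈ C.1 ++ C.2, ∀ v ∈ m.2,
      UPoly.toPoly (q.getD (Encodable.encode v) []) = Q v := by
    intro C hC m hm v hv
    have := encode_lt_numVars hC hm hv
    rw [List.getD_eq_getElem _ _ (by simpa [q] using this)]
    simp only [q, List.getElem_map, List.getElem_range, Encodable.encodek, Option.map_some,
      Option.getD_some, hcode]
  refine ⟨(code p, rat a, rat b, q, S.map fun C => (code (σ C), code (H C))), ⟨?_, ?_⟩, ?_⟩
  · rw [← Int.cast_lt (R := ℚ), Int.cast_zero]
    have h : (UPoly.eval (rat a) (code p)).val < 0 := by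
      rw [UPoly.val_eval, hcode, hrat]; exact ha
    rw [RatCode.val] at h
    exact neg_of_div_neg_left h (by positivity)
  · rw [← RatCode.val_pos, UPoly.val_eval, hcode, hrat]
    exact hb
  · intro C hC
    refine ⟨_, List.mem_map_of_mem hC, witnesses_iff.2 ?_⟩
    simp only [hcode]
    rw [NPoly.eval_congr fun m hm v hv => hq C hC m (List.mem_append_left _ hm) v hv,
      NPoly.eval_congr fun m hm v hv => hq C hC m (List.mem_append_right _ hm) v hv]
    exact hH C hC

end

end TwnLoop

theorem mainTheorem8 :
    -- the reduction to the existential theory of the real algebraic numbers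
    (∃ F : TwnLoop.LoopCode × ℕ → TwnLoop.ExCode, Computable F ∧
      ∀ (R : Subring TwnLoop.RealAlg) (d : ℕ), 1 ≤ d →
        ∀ (L : TwnLoop.Loop R d) (c : TwnLoop.LoopCode), c.Denotes L.baseChange →
          ∀ δ : ℕ, ∃ χ : TwnLoop.ExSentence, (F (c, δ)).Denotes χ ∧
            (χ.Valid ↔
              ∃ η : TwnLoop.PolyAut TwnLoop.RealAlg d,
                η.deg ≤ δ ∧ (L.baseChange.Tr η).IsTwn)) ∧
    -- semi-decidability of twn-transformability
    (∃ P : TwnLoop.LoopCode → Prop, REPred P ∧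
      ∀ (R : Subring TwnLoop.RealAlg) (d : ℕ), 1 ≤ d →
        ∀ (L : TwnLoop.Loop R d) (c : TwnLoop.LoopCode), c.Denotes L.baseChange →
          (P c ↔ TwnLoop.TwnTransformable L)) := by
  open TwnLoop in
  refine ⟨⟨reduction, primrec_reduction.to_comp, fun R d _ L c hc δ => ?_⟩,
    ⟨fun c => ∃ x : ℕ × Certificate, Certifies (system (c, x.1)) x.2, ?_,
      fun R d _ L c hc => ?_⟩⟩
  · exact ⟨systemSentence (system (c, δ)), denotes_systemSentence _,
      (valid_systemSentence _).trans (exists_sat_system_iff hc δ)⟩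
  · exact rePred_exists (primrecRel_certifies.comp (primrec_system.comp
      (Primrec.fst.pair (Primrec.fst.comp Primrec.snd))) (Primrec.snd.comp Primrec.snd))
  · constructor
    · rintro ⟨⟨δ, w⟩, hw⟩
      obtain ⟨η, -, hη⟩ := (exists_sat_system_iff hc δ).1 (exists_sat_of_certifies hw)
      exact ⟨η, hη⟩
    · rintro ⟨η, hη⟩
      obtain ⟨y, hy⟩ := (exists_sat_system_iff hc η.deg).2 ⟨η, le_rfl, hη⟩
      obtain ⟨w, hw⟩ := exists_certifies_of_sat hy
      exact ⟨(η.deg, w), hw⟩
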